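/- **Conventions.** All schemes are arbitrary (not necessarily noetherian); $k(X)$ is the function field of an integral scheme $X$. - A *partial normalization* of a reduced scheme $Y_0$ with finitely many irreducible components is a scheme $\mathbf{Spec}(\mathcal F)\to Y_0$, where $\mathcal F$ is a quasi-coherent $\mathcal O_{Y_0}$-subalgebra of the normalization of $\mathcal O_{Y_0}$ in its sheaf of meromorphic functions (total rings of fractions). A morphism $f:Y\to X$ is of *normalized finite type* if it is the composition of a partial normalization $Y\to Y_0$ and a morphism of finite type $Y_0\to X$. - A homomorphism $R\to S$ of local rings is *strictly local-étale* if it is local, $S$ is $R$-isomorphic to the localization of an étale $R$-algebra at a prime ideal, and the residue field extension is trivial. - $f:Y\to X$ is *strictly étale at* $y$ if it is étale on an open neighborhood of $y$ and $\kappa(f(y))\to\kappa(y)$ is an isomorphism. - A valuation ring $\mathcal O$ of $k(X)$ (that is, with fraction field $k(X)$; $\mathcal O=k(X)$ is allowed) is *centered on* $x\in X$ if it dominates $\mathcal O_{X,x}$. If $f:Y\to X$ is dominant, a valuation ring $\mathcal O'$ of $k(Y)$ *extends* $\mathcal O$ if $\mathcal O'\cap k(X)=\mathcal O$. **Theorem.**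 Let $f:Y\to X$ be a dominant morphism of normalized finite type between integral schemes, let $y\in Y$ and $x=f(y)$. Assume that the local ring $\mathcal O_{X,x}$ is integrally closed and that $y$ is an isolated point of the fiber $f^{-1}(x)$. Consider the condition (V) there exists a valuation ring $\mathcal O$ of $k(X)$ centered on $x$ which admits a unique extension to a valuation ring $\mathcal O'$ of $k(Y)$ centered on $y$, and this $\mathcal O'$ is strictly local-étale over $\mathcal O$. Then: 1. $\mathcal O_{X,x}\to\mathcal O_{Y,y}$ is strictly local-étale if and only if (V) holds. 2. If, moreover, $X$ is normal at all points of some neighborhood of $x$, or the restriction of $f$ to some neighborhood of $y$ is locally of finite type, then $f$ is strictly étale at $y$ if and only if (V) holds. -/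

import Mathlib

universe u

open AlgebraicGeometry CategoryTheory

namespace BirationalEtale

/-- A morphism `g : Y ⟶ Y₀`, with `Y₀` reduced and having finitely many irreducible components, is a
partial normalization if it is (isomorphic to) the relative spectrum of a subring of the
normalization of the structure sheaf of `Y₀` in its sheaf of meromorphic functions: `g` is affine
and, over every affine open `U`, the `Γ(Y₀, U)`-algebra `Γ(Y, g⁻¹ U)` embeds into the integral
closure of `Γ(Y₀, U)` in its total ring of fractions. Such an embedding of algebras is unique, so
the embeddings over the various `U` are automatically compatible. -/
structure IsPartialNormalization {Y Y₀ : Scheme.{u}} (g : Y ⟶ Y₀) : Prop where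
  isReduced : IsReduced Y₀
  finite_components : (irreducibleComponents Y₀).Finite
  isAffineHom : IsAffineHom g
  exists_embedding : ∀ U : Y₀.Opens, IsAffineOpen U →
    ∃ φ : Γ(Y, g ⁻¹ᵁ U) →+* integralClosure Γ(Y₀, U) (FractionRing Γ(Y₀, U)),
      Function.Injective φ ∧
        φ.comp (g.app U).hom =
          algebraMap Γ(Y₀, U) (integralClosure Γ(Y₀, U) (FractionRing Γ(Y₀, U)))

/-- A morphism of normalized finite type: a partial normalization followed by a morphism of
finite type. -/
def IsNormalizedFiniteType {X Y : Scheme.{u}} (f : Y ⟶ X) : Prop :=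
  ∃ (Y₀ : Scheme.{u}) (g : Y ⟶ Y₀) (h : Y₀ ⟶ X),
    IsPartialNormalization g ∧ LocallyOfFiniteType h ∧ QuasiCompact h ∧ g ≫ h = f

/-- `y` is an isolated point of the fiber of `f` through `y`. -/
def IsIsolatedInFiber {X Y : Scheme.{u}} (f : Y ⟶ X) (y : Y) : Prop :=
  ∃ U : Y.Opens, (U : Set Y) ∩ f ⁻¹' {f y} = {y}

/-- `X` is normal at `x` (for `X` integral, so that the local rings are domains). -/
def IsNormalAt (X : Scheme.{u}) (x : X) : Prop :=
  IsIntegrallyClosed (X.presheaf.stalk x)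

/-- `X` is normal at all points of some neighborhood of `x`. -/
def IsNormalNear (X : Scheme.{u}) (x : X) : Prop :=
  ∃ U : X.Opens, x ∈ U ∧ ∀ z ∈ U, IsNormalAt X z

/-- `f` is locally of finite type at `y`. -/
def IsFiniteTypeNear {X Y : Scheme.{u}} (f : Y ⟶ X) (y : Y) : Prop :=
  ∃ V : Y.Opens, y ∈ V ∧ LocallyOfFiniteType (V.ι ≫ f)

/-- `f` is étale at `y`: it is étale on a neighborhood of `y`. -/
def IsEtaleAt {X Y : Scheme.{u}} (f : Y ⟶ X) (y : Y) : Prop :=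
  ∃ V : Y.Opens, y ∈ V ∧ Etale (V.ι ≫ f)

/-- `f` is strictly étale at `y`: étale at `y` and inducing an isomorphism of residue fields. -/
def IsStrictlyEtaleAt {X Y : Scheme.{u}} (f : Y ⟶ X) (y : Y) : Prop :=
  IsEtaleAt f y ∧ Function.Bijective (f.residueFieldMap y).hom

/-- `S` is, via `φ`, the localization of an étale `R`-algebra `B` at a prime ideal. -/
def IsEssentiallyEtale {R S : Type u} [CommRing R] [CommRing S] (φ : R →+* S) : Prop :=
  ∃ (B : Type u) (_ : CommRing B) (i : R →+* B) (j : B →+* S) (q : Ideal B) (_ : q.IsPrime),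
    i.Etale ∧ j.comp i = φ ∧
      letI : Algebra B S := j.toAlgebra
      IsLocalization.AtPrime S q

/-- A strictly local-étale homomorphism of local rings: a local homomorphism which is the
localization of an étale homomorphism and induces an isomorphism of residue fields. -/
def IsStrictlyLocalEtale {R S : Type u} [CommRing R] [IsLocalRing R] [CommRing S] [IsLocalRing S]
    (φ : R →+* S) : Prop :=
  IsEssentiallyEtale φ ∧
    ∃ _ : IsLocalHom φ, Function.Bijective (IsLocalRing.ResidueField.map φ)

theorem map_genericPoint {X Y : Scheme.{u}} [IrreducibleSpace X] [IrreducibleSpace Y]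
    (f : Y ⟶ X) [IsDominant f] : f (genericPoint Y) = genericPoint X := by
  apply IsGenericPoint.eq (S := Set.univ) _ (genericPoint_spec X)
  have h := (genericPoint_spec Y).image f.continuous
  rwa [Set.image_univ, f.denseRange.closure_range] at h

/-- The embedding of function fields `k(X) → k(Y)` induced by a dominant morphism `f : Y ⟶ X`. -/
noncomputable def functionFieldMap {X Y : Scheme.{u}} [IsIntegral X] [IsIntegral Y]
    (f : Y ⟶ X) [IsDominant f] : X.functionField →+* Y.functionField :=
  (X.presheaf.stalkSpecializes (specializes_of_eq (map_genericPoint f)) ≫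
    f.stalkMap (genericPoint Y)).hom

/-- The valuation ring `O` of `k(X)` is centered on `x`: it contains the local ring of `X` at `x`,
and its maximal ideal contains the maximal ideal of that local ring. -/
def IsCenteredOn {X : Scheme.{u}} [IsIntegral X] (O : ValuationSubring X.functionField) (x : X) :
    Prop :=
  (∀ a : X.presheaf.stalk x, algebraMap _ X.functionField a ∈ O) ∧
    ∀ a ∈ IsLocalRing.maximalIdeal (X.presheaf.stalk x),
      algebraMap _ X.functionField a ∈ O.nonunits

/-- The valuation ring `O'` of `L` extends the valuation ring `O` of `K`, along `φ : K →+* L`. -/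
def Extends {K L : Type u} [Field K] [Field L] (φ : K →+* L) (O : ValuationSubring K)
    (O' : ValuationSubring L) : Prop :=
  O'.comap φ = O

/-- The homomorphism `O → O'` given by an extension of valuation rings. -/
def Extends.ringHom {K L : Type u} [Field K] [Field L] {φ : K →+* L} {O : ValuationSubring K}
    {O' : ValuationSubring L} (h : Extends φ O O') : O →+* O' :=
  φ.restrict O O' (fun a ha => by
    have ha' : a ∈ O'.comap φ := by rw [h]; exact ha
    exact ha')

/-- There is a valuation ring `O` of `k(X)` centered on `f y` which has a unique extension to a
valuation ring `O'` of `k(Y)` centered on `y`, and this `O'` is strictly local-étale over `O`. -/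
def ValuativeCondition {X Y : Scheme.{u}} [IsIntegral X] [IsIntegral Y] (f : Y ⟶ X) [IsDominant f]
    (y : Y) : Prop :=
  ∃ O : ValuationSubring X.functionField, IsCenteredOn O (f y) ∧
    ∃ O' : ValuationSubring Y.functionField,
      ∃ h : Extends (functionFieldMap f) O O',
        IsCenteredOn O' y ∧
        (∀ O'' : ValuationSubring Y.functionField,
          Extends (functionFieldMap f) O O'' → IsCenteredOn O'' y → O'' = O') ∧
        IsStrictlyLocalEtale h.ringHom

end BirationalEtale

/-! Write `A`, `B` for the local rings at `x`, `y` and `K`, `L` for the function fields. Everything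
rests on a concrete form of "strictly local-étale", `IsEtaleGenerator`: some `t` in the maximal
ideal of `B` is integral over `A`, its minimal polynomial has unit derivative at `t`, and every
element of `B` is a fraction `u(t)/v(t)`. Euler's trace formula then shows that `B` is integrally
closed.

From the local ring to valuations (`IsEtaleGenerator.exists_valuationSubring`): take any valuation
ring `O'` of `L` dominating `B`, and let `O` be its trace on `K`. The fractions in `t` over `O` form
an integrally closed local ring with fraction field `L`. Every element of `L` is a root of a
polynomial over `O` with a coefficient 1, so it or its inverse is such a fraction, and this ring is
all of `O'`. Which denominators are allowed depends only on `O`, whence uniqueness.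

From valuations to the local ring (`exists_isEtaleGenerator_of_extends`): Zariski's main theorem
(`exists_isIntegral_mul_eq_of_isolated`) makes `B` a localization of the integral closure `D` of `A`
in `B`. Extend `O'` to a valuation ring `W` of an algebraic closure of `L`. Each `K`-embedding `σ`
of `L` then defines a maximal ideal of `D`. Uniqueness of `O'`, with uniqueness of simple roots in
the maximal ideal, separates the ideal of the inclusion `τ` from all the others. An element `c` of
`D` that is 1 modulo that ideal and lies in all the others is primitive, the derivative of its
minimal polynomial is a unit at `c`, and `c - 1` generates `B`.

For the second assertion, `exists_etale_away` spreads `t` out to a standard étale algebra over an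
affine open of `X`. Finite type or normality places the sections of `Y` inside that algebra, and
inverting one further section makes the two rings agree. -/

namespace BirationalEtale

open Polynomial IsLocalRing

/-! ### Homomorphisms out of standard étale algebras -/

section StandardEtale

variable {R B : Type*} [CommRing R] [CommRing B] [Algebra R B] (P : StandardEtalePair R)

theorem _root_.StandardEtalePair.exists_mul_pow_eq (e : P.Ring) :
    ∃ p : R[X], ∃ n, e * aeval P.X P.g ^ n = aeval P.X p :=
  let pr : StandardEtalePresentation R P.Ring :=
    ⟨P, P.X, P.hasMap_X, by simpa [StandardEtalePair.lift_X_left] using Function.bijective_id⟩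
  pr.exists_mul_aeval_x_g_pow_eq_aeval_x e

variable {P} {t : B} (ht : P.HasMap t)

theorem _root_.StandardEtalePair.lift_aeval (u : R[X]) :
    P.lift t ht (aeval P.X u) = aeval t u := by
  rw [← aeval_algHom_apply, StandardEtalePair.lift_X]

/-- Up to a power of the unit `g(X)`, every element of the algebra is a polynomial in `X`. For an
element of the kernel this polynomial vanishes at `t`, so it is a multiple of `f` and dies in the
algebra. -/
theorem _root_.StandardEtalePair.lift_injective
    (h : ∀ p : R[X], aeval t p = 0 → P.f ∣ p) : Function.Injective (P.lift t ht) := by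
  rw [injective_iff_map_eq_zero]
  intro e he
  obtain ⟨p, n, hp⟩ := P.exists_mul_pow_eq e
  obtain ⟨r, rfl⟩ := h p (by rw [← StandardEtalePair.lift_aeval ht, ← hp, map_mul, he, zero_mul])
  rw [map_mul, P.hasMap_X.1, zero_mul] at hp
  exact ((P.hasMap_X.2.pow n).mul_left_eq_zero).1 hp

end StandardEtale

/-! ### Étale generators of a local ring -/

section Generator

variable {A B : Type*} [CommRing A] [CommRing B] [Algebra A B]

/-- The fractions `u(t) / v(t)` in `B`, for polynomials `u`, `v` over `A` with `v(t)` a unit. -/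
def fractionsAdjoin (A : Type*) {B : Type*} [CommRing A] [CommRing B] [Algebra A B] (t : B) :
    Subalgebra A B where
  carrier := {b | ∃ u v : A[X], IsUnit (aeval t v) ∧ b * aeval t v = aeval t u}
  mul_mem' := by
    rintro b c ⟨u, v, hv, h⟩ ⟨u', v', hv', h'⟩
    refine ⟨u * u', v * v', by simpa using ⟨hv, hv'⟩, ?_⟩
    simp only [map_mul, ← h, ← h']
    ring
  add_mem' := by
    rintro b c ⟨u, v, hv, h⟩ ⟨u', v', hv', h'⟩
    refine ⟨u * v' + u' * v, v * v', by simpa using ⟨hv, hv'⟩, ?_⟩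
    simp only [map_mul, map_add, ← h, ← h']
    ring
  algebraMap_mem' a := ⟨C a, 1, by simp, by simp⟩

theorem aeval_mem_fractionsAdjoin (t : B) (u : A[X]) : aeval t u ∈ fractionsAdjoin A t :=
  ⟨u, 1, by simp, by simp⟩

theorem self_mem_fractionsAdjoin (t : B) : t ∈ fractionsAdjoin A t := by
  simpa using aeval_mem_fractionsAdjoin (A := A) t X

/-- If `u(t)/v(t)` is a unit of `B`, then so is `u(t)`, and `v(t)/u(t)` is again an admissible
fraction. Locality of the ring of fractions is inherited from `B` in this way. -/
instance isLocalHom_fractionsAdjoin_val (t : B) :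
    IsLocalHom (algebraMap (fractionsAdjoin A t) B) where
  map_nonunit := by
    rintro ⟨b, u, v, hv, h⟩ (hb : IsUnit b)
    have hu : IsUnit (aeval t u) := h ▸ hb.mul hv
    obtain ⟨c, hc⟩ := hb.exists_right_inv
    refine IsUnit.of_mul_eq_one ⟨c, v, u, hu, ?_⟩ (Subtype.ext hc)
    rw [← h, ← mul_assoc, mul_comm c, hc, one_mul]

instance isLocalRing_fractionsAdjoin [IsLocalRing B] (t : B) :
    IsLocalRing (fractionsAdjoin A t) :=
  RingHom.domain_isLocalRing (algebraMap (fractionsAdjoin A t) B)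

/-- `t` generates the local ring `B` over `A` as the localization of a monogenic algebra which is
étale at the origin `t = 0`. -/
structure IsEtaleGenerator (A : Type*) {B : Type*} [CommRing A] [CommRing B] [IsLocalRing B]
    [Algebra A B] (t : B) : Prop where
  isIntegral : IsIntegral A t
  mem_maximalIdeal : t ∈ maximalIdeal B
  isUnit : IsUnit (aeval t (derivative (minpoly A t)))
  eq_top : fractionsAdjoin A t = ⊤

variable [IsDomain A] [IsIntegrallyClosed A] [IsDomain B] [FaithfulSMul A B]

/-- Over an integrally closed domain `F` is a multiple of the minimal polynomial, so at the root `t`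
the derivative of the latter divides that of `F`. Any convenient equation can thus be used to test
the unit condition. -/
theorem isUnit_aeval_derivative_minpoly {t : B} (ht : IsIntegral A t) {F : A[X]}
    (h0 : aeval t F = 0)
    (h1 : IsUnit (aeval t (derivative F))) : IsUnit (aeval t (derivative (minpoly A t))) := by
  obtain ⟨g, hg⟩ := minpoly.isIntegrallyClosed_dvd ht h0
  rw [hg] at h1
  simp only [derivative_mul, map_add, map_mul, minpoly.aeval, zero_mul, add_zero] at h1
  exact isUnit_of_mul_isUnit_left h1

/-- Residues of `B` lift to `A`, so the standard generator can be translated by some `c` in `A` into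
the maximal ideal. Composing with `X + C c` carries its polynomial relations along. -/
theorem IsEtaleGenerator.exists_of_isStandardEtale [IsLocalRing B] {E : Type*} [CommRing E]
    [Algebra A E] [Algebra.IsStandardEtale A E] (j : E →ₐ[A] B)
    (hj : ∀ b : B, ∃ e s : E, IsUnit (j s) ∧ b * j s = j e)
    (hres : ∀ b : B, ∃ a : A, b - algebraMap A B a ∈ maximalIdeal B) :
    ∃ t : B, IsEtaleGenerator A t := by
  obtain ⟨P⟩ : Nonempty (StandardEtalePresentation A E) := inferInstance
  obtain ⟨c, hc⟩ := hres (j P.x)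
  have hev : ∀ u : A[X], aeval (j P.x - algebraMap A B c) (u.comp (X + C c)) = j (aeval P.x u) := by
    intro u
    rw [aeval_comp]
    simp [aeval_algHom_apply]
  have hg : IsUnit (j (aeval P.x P.g)) := P.hasMap.2.map j
  have h0 : aeval (j P.x - algebraMap A B c) (P.f.comp (X + C c)) = 0 := by
    rw [hev, P.hasMap.1, map_zero]
  refine ⟨j P.x - algebraMap A B c, ⟨_, P.monic_f.comp_X_add_C c, h0⟩, hc,
    isUnit_aeval_derivative_minpoly ⟨_, P.monic_f.comp_X_add_C c, h0⟩ h0 ?_, ?_⟩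
  · have : derivative (P.f.comp (X + C c)) = (derivative P.f).comp (X + C c) := by
      simp [derivative_comp]
    rw [this, hev]
    exact P.hasMap.isUnit_derivative_f.map j
  · rw [eq_top_iff]
    rintro b -
    obtain ⟨e, s, hs, hb⟩ := hj b
    obtain ⟨p, n, hp⟩ := P.exists_mul_aeval_x_g_pow_eq_aeval_x e
    obtain ⟨q, m, hq⟩ := P.exists_mul_aeval_x_g_pow_eq_aeval_x s
    refine ⟨(p * P.g ^ m).comp (X + C c), (q * P.g ^ n).comp (X + C c), ?_, ?_⟩
    · rw [hev]
      simp only [map_mul, map_pow, ← hq]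
      exact (hs.mul (hg.pow _)).mul (hg.pow _)
    · rw [hev, hev]
      simp only [map_mul, map_pow, ← hq, ← hp, ← hb]
      ring

end Generator

/-! ### Strictly local-étale homomorphisms and generators -/

section StrictlyLocalEtale

variable {A B : Type u} [CommRing A] [IsLocalRing A] [CommRing B] [IsLocalRing B] [Algebra A B]
  [IsDomain A] [IsIntegrallyClosed A] [IsDomain B] [FaithfulSMul A B]

theorem IsStrictlyLocalEtale.exists_isEtaleGenerator
    (h : IsStrictlyLocalEtale (algebraMap A B)) : ∃ t : B, IsEtaleGenerator A t := by
  obtain ⟨⟨E, _, i, j, q, _, hi, hij, hloc⟩, hlh, hbij⟩ := h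
  algebraize [i, j]
  have : IsScalarTower A E B := .of_algebraMap_eq' hij.symm
  obtain ⟨f, hf, _⟩ := Algebra.IsEtaleAt.exists_isStandardEtale (R := A) q
  have hfu : IsUnit (algebraMap E B f) := IsLocalization.map_units B (⟨f, hf⟩ : q.primeCompl)
  let l : Localization.Away f →ₐ[A] B :=
    IsLocalization.Away.liftAlgHom f (f := IsScalarTower.toAlgHom A E B) hfu
  have hl (e : E) : l (algebraMap E _ e) = algebraMap E B e :=
    IsLocalization.lift_eq _ e
  refine IsEtaleGenerator.exists_of_isStandardEtale l ?_ ?_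
  · intro b
    obtain ⟨⟨e, s⟩, hb⟩ := IsLocalization.surj q.primeCompl b
    refine ⟨algebraMap _ _ e, algebraMap _ _ s.1, ?_, ?_⟩
    · rw [hl]
      exact IsLocalization.map_units B s
    · rw [hl, hl, hb]
  · intro b
    obtain ⟨a, ha⟩ := hbij.2 (residue B b)
    obtain ⟨a, rfl⟩ := residue_surjective a
    refine ⟨a, ?_⟩
    rw [← residue_eq_zero_iff, map_sub, ← ha, ResidueField.map_residue, sub_self]

/-- The étale model is `A[X]/(m)` with `m'` inverted, where `m` is the minimal polynomial of `t`. It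
embeds in `B` because `m` divides every relation of `t`. Since `t` has residue 0, the residue of
`w(t)` is that of the constant term of `w`, so the residue field does not grow. -/
theorem IsEtaleGenerator.isStrictlyLocalEtale [IsLocalHom (algebraMap A B)] {t : B}
    (h : IsEtaleGenerator A t) : IsStrictlyLocalEtale (algebraMap A B) := by
  let P : StandardEtalePair A :=
    ⟨minpoly A t, minpoly.monic h.isIntegral, derivative (minpoly A t), 1, 0, 1, by simp⟩
  have hP : P.HasMap t := ⟨minpoly.aeval _ _, h.isUnit⟩
  let j := P.lift t hP
  have hj := StandardEtalePair.lift_aeval hP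
  have hinj : Function.Injective j :=
    StandardEtalePair.lift_injective hP fun p hp => minpoly.isIntegrallyClosed_dvd h.isIntegral hp
  have hmem (b : B) : ∃ u v : A[X], IsUnit (aeval t v) ∧ b * aeval t v = aeval t u := by
    have : b ∈ fractionsAdjoin A t := h.eq_top ▸ trivial
    exact this
  refine ⟨⟨P.Ring, inferInstance, algebraMap A P.Ring, j.toRingHom,
    (maximalIdeal B).comap j.toRingHom, inferInstance, ?_, j.comp_algebraMap, ?_⟩,
    inferInstance, RingHom.injective _, ?_⟩
  · rw [RingHom.etale_algebraMap]
    infer_instance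
  · let : Algebra P.Ring B := j.toRingHom.toAlgebra
    refine ⟨⟨?_, ?_, ?_⟩⟩
    · rintro ⟨e, he⟩
      exact not_not.1 he
    · intro b
      obtain ⟨u, v, hv, hb⟩ := hmem b
      refine ⟨⟨aeval P.X u, aeval P.X v, ?_⟩, ?_⟩
      · change ¬ (j (aeval P.X v) ∈ maximalIdeal B)
        rw [hj]
        simpa using hv
      · change b * j (aeval P.X v) = j (aeval P.X u)
        rw [hj, hj, hb]
    · intro e e' hee
      exact ⟨1, by rw [hinj hee]⟩
  · intro b
    obtain ⟨b, rfl⟩ := residue_surjective b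
    obtain ⟨u, v, hv, hb⟩ := hmem b
    have key : ∀ w : A[X], residue B (aeval t w) =
        ResidueField.map (algebraMap A B) (residue A (w.coeff 0)) := by
      intro w
      rw [ResidueField.map_residue, ← sub_eq_zero, ← map_sub, residue_eq_zero_iff]
      nth_rw 1 [← divX_mul_X_add w]
      simp only [map_add, map_mul, aeval_X, aeval_C, add_sub_cancel_right]
      exact Ideal.mul_mem_left _ _ h.mem_maximalIdeal
    have hv' : residue B (aeval t v) ≠ 0 := (hv.map (residue B)).ne_zero
    refine ⟨residue A (u.coeff 0) / residue A (v.coeff 0), ?_⟩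
    rw [map_div₀, ← key, ← key, ← hb, map_mul, mul_div_cancel_right₀ _ hv']

end StrictlyLocalEtale

/-! ### The trace form and the conductor of a monogenic algebra -/

section IntegralClosure

variable {A K L : Type*} [CommRing A] [IsDomain A] [IsIntegrallyClosed A] [Field K] [Field L]
  [Algebra A K] [IsFractionRing A K] [Algebra K L] [Algebra A L] [IsScalarTower A K L]

theorem isSeparable_of_aeval_derivative_ne_zero {t : L} (ht : IsIntegral K t)
    (h : aeval t (derivative (minpoly K t)) ≠ 0) : IsSeparable K t := by
  rw [IsSeparable, separable_iff_derivative_ne_zero (minpoly.irreducible ht)]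
  rintro h0
  simp [h0] at h

theorem finiteDimensional_of_adjoin_eq_top {t : L} (ht : IsIntegral K t)
    (htop : Algebra.adjoin K {t} = ⊤) : FiniteDimensional K L := by
  have := ht.fg_adjoin_singleton
  rw [htop] at this
  exact ⟨this⟩

theorem algebraIsSeparable_of_adjoin_eq_top {t : L} (ht : IsIntegral K t)
    (htop : Algebra.adjoin K {t} = ⊤)
    (h : aeval t (derivative (minpoly K t)) ≠ 0) : Algebra.IsSeparable K L := by
  have hs := (IntermediateField.isSeparable_adjoin_simple_iff_isSeparable K L).2
    (isSeparable_of_aeval_derivative_ne_zero ht h)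
  have : IntermediateField.adjoin K {t} = ⊤ := by
    rw [eq_top_iff]
    rintro x -
    exact IntermediateField.algebra_adjoin_le_adjoin K {t} (htop ▸ Algebra.mem_top)
  rw [this] at hs
  exact (AlgEquiv.Algebra.isSeparable_iff (IntermediateField.topEquiv (F := K) (E := L))).1 hs

variable (K) in
/-- The derivative of the minimal polynomial of a generator lies in the conductor. -/
theorem aeval_derivative_minpoly_mul_mem_adjoin {t : L} (ht : IsIntegral A t)
    (htop : Algebra.adjoin K {t} = ⊤)
    (h : aeval t (derivative (minpoly K t)) ≠ 0) {z : L} (hz : IsIntegral A z) :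
    aeval t (derivative (minpoly K t)) * z ∈ Algebra.adjoin A {t} := by
  have htK : IsIntegral K t := ht.tower_top
  have := finiteDimensional_of_adjoin_eq_top htK htop
  have := algebraIsSeparable_of_adjoin_eq_top htK htop h
  -- Traces of integral elements lie in `A`, so `z` is in the trace dual of `A[t]`. By Euler's
  -- formula this dual is `A[t]` divided by the derivative at `t`.
  have hmem : z ∈ (Algebra.traceForm K L).dualSubmodule
      (Subalgebra.toSubmodule (Algebra.adjoin A {t})) := by
    rw [LinearMap.BilinForm.mem_dualSubmodule]
    intro y hy
    have hy' : IsIntegral A y :=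
      (_root_.adjoin_le_integralClosure ht : Algebra.adjoin A {t} ≤ integralClosure A L) hy
    rw [Submodule.mem_one]
    exact (IsIntegrallyClosed.isIntegral_iff).1 (Algebra.isIntegral_trace (hz.mul hy'))
  rw [traceForm_dualSubmodule_adjoin A K htop ht, Submodule.mem_smul_pointwise_iff_exists] at hmem
  obtain ⟨w, hw, rfl⟩ := hmem
  rwa [smul_eq_mul, mul_inv_cancel_left₀ h]

end IntegralClosure

/-! ### Fraction fields and integral closedness -/

section FractionField

variable {A B K L : Type*} [CommRing A] [CommRing B] [Algebra A B] [Field K] [Field L]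
  [Algebra A K] [Algebra B L] [Algebra K L] [Algebra A L]
  [IsScalarTower A K L] [IsScalarTower A B L]

theorem exists_smul_eq_aeval_of_adjoin_eq_top [IsDomain A] [IsFractionRing A K] {t : L}
    (htop : Algebra.adjoin K {t} = ⊤) (z : L) :
    ∃ a : A, a ≠ 0 ∧ ∃ u : A[X], algebraMap A L a * z = aeval t u := by
  have hz : z ∈ Algebra.adjoin K {t} := htop ▸ Algebra.mem_top
  rw [Algebra.adjoin_singleton_eq_range_aeval] at hz
  obtain ⟨w, rfl⟩ := hz
  obtain ⟨a, ha, hw⟩ := IsLocalization.integerNormalization_spec (nonZeroDivisors A) w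
  refine ⟨a, nonZeroDivisors.ne_zero ha,
    IsLocalization.integerNormalization (nonZeroDivisors A) w, ?_⟩
  rw [← aeval_map_algebraMap K, hw, ← algebraMap_smul K a w]
  simp [Algebra.smul_def, ← IsScalarTower.algebraMap_apply]

variable (K L) in
theorem isFractionRing_of_adjoin_eq_top [IsDomain A] [IsFractionRing A K] [FaithfulSMul B L]
    {t : B} (htop : Algebra.adjoin K {algebraMap B L t} = ⊤) : IsFractionRing B L := by
  have hAL : Function.Injective (algebraMap A L) := by
    rw [IsScalarTower.algebraMap_eq A K L]
    exact (algebraMap K L).injective.comp (IsFractionRing.injective A K)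
  refine IsFractionRing.of_field _ _ fun z => ?_
  obtain ⟨a, ha, u, hz⟩ := exists_smul_eq_aeval_of_adjoin_eq_top (A := A) htop z
  refine ⟨aeval t u, algebraMap A B a, ?_⟩
  rw [← IsScalarTower.algebraMap_apply, ← aeval_algebraMap_apply, ← hz, mul_div_cancel_left₀]
  simpa using (map_ne_zero_iff _ hAL).2 ha

variable (K L) in
theorem IsEtaleGenerator.adjoin_eq_top [IsLocalRing B] [IsFractionRing B L] {t : B}
    (h : IsEtaleGenerator A t) :
    Algebra.adjoin K {algebraMap B L t} = ⊤ := by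
  have halg : IsAlgebraic K (algebraMap B L t) :=
    (h.isIntegral.algebraMap (B := L)).tower_top.isAlgebraic
  have hB (b : B) : algebraMap B L b ∈ IntermediateField.adjoin K {algebraMap B L t} := by
    obtain ⟨u, v, hv, hb⟩ : b ∈ fractionsAdjoin A t := h.eq_top ▸ trivial
    have hmem (w : A[X]) : algebraMap B L (aeval t w) ∈
        IntermediateField.adjoin K {algebraMap B L t} := by
      rw [← aeval_algebraMap_apply, ← aeval_map_algebraMap K]
      exact IntermediateField.algebra_adjoin_le_adjoin K _
        (Polynomial.aeval_mem_adjoin_singleton K _)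
    rw [eq_div_of_mul_eq (hv.map (algebraMap B L)).ne_zero
      ((map_mul _ _ _).symm.trans (congrArg _ hb))]
    exact div_mem (hmem u) (hmem v)
  rw [← IntermediateField.adjoin_simple_toSubalgebra_of_isAlgebraic halg, eq_top_iff]
  rintro z -
  obtain ⟨b, c, -, rfl⟩ := IsFractionRing.div_surjective B z
  exact (div_mem (hB b) (hB c) : _ ∈ IntermediateField.adjoin K {algebraMap B L t})

variable [IsDomain A] [IsIntegrallyClosed A] [IsFractionRing A K] [IsDomain B]

variable (K L) in
theorem minpoly_algebraMap_eq_map {t : B} (ht : IsIntegral A t) :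
    minpoly K (algebraMap B L t) = (minpoly A t).map (algebraMap A K) :=
  minpoly.isIntegrallyClosed_eq_field_fractions K L ht

variable (K L) in
theorem aeval_derivative_minpoly_algebraMap {t : B} (ht : IsIntegral A t) :
    aeval (algebraMap B L t) (derivative (minpoly K (algebraMap B L t))) =
      algebraMap B L (aeval t (derivative (minpoly A t))) := by
  rw [minpoly_algebraMap_eq_map K L ht, derivative_map, aeval_map_algebraMap,
    aeval_algebraMap_apply]

/-- A domain which is local-étale over an integrally closed domain is integrally closed. -/
theorem IsEtaleGenerator.isIntegrallyClosed {A B : Type*} (K L : Type*) [CommRing A] [CommRing B]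
    [Algebra A B] [Field K] [Field L] [Algebra A K] [Algebra B L] [Algebra K L] [Algebra A L]
    [IsScalarTower A K L] [IsScalarTower A B L] [IsDomain A] [IsIntegrallyClosed A]
    [IsFractionRing A K] [IsDomain B] [IsLocalRing B] [IsFractionRing B L] {t : B}
    (h : IsEtaleGenerator A t) : IsIntegrallyClosed B := by
  rw [isIntegrallyClosed_iff L]
  intro z hz
  have hBL := IsFractionRing.injective B L
  -- `B` is the localization of `A[t]` at the elements that become units in `B`. A multiple of `z`
  -- by such an element `m` is integral over `A[t]`, hence over `A`. The conductor bound then puts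
  -- `m z` times the derivative, itself a unit of `B`, into `A[t]`.
  let M : Submonoid (Algebra.adjoin A {t}) :=
    (IsUnit.submonoid B).comap (Algebra.adjoin A {t}).val
  have hloc : IsLocalization M B := by
    refine ⟨⟨fun m => m.2, fun b => ?_, fun _ => ⟨1, ?_⟩⟩⟩
    · obtain ⟨u, v, hv, hb⟩ : b ∈ fractionsAdjoin A t := h.eq_top ▸ trivial
      exact ⟨⟨⟨aeval t u, aeval_mem_adjoin_singleton A t⟩,
        ⟨⟨aeval t v, aeval_mem_adjoin_singleton A t⟩, hv⟩⟩, hb⟩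
    · rename_i hxy
      rw [Subtype.ext hxy]
  obtain ⟨m, hm⟩ := hz.exists_multiple_integral_of_isLocalization M z
  have hint : Algebra.IsIntegral A (Algebra.adjoin A {t}) := Algebra.IsIntegral.adjoin (by
    simpa using h.isIntegral)
  have hmz : IsIntegral A (m • z) := isIntegral_trans _ hm
  have hder := aeval_derivative_minpoly_algebraMap K L h.isIntegral
  have hne : aeval (algebraMap B L t) (derivative (minpoly K (algebraMap B L t))) ≠ 0 := by
    rw [hder]
    exact (h.isUnit.map _).ne_zero
  have hmem := aeval_derivative_minpoly_mul_mem_adjoin K (h.isIntegral.algebraMap (B := L))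
    (h.adjoin_eq_top K L) hne hmz
  rw [Algebra.adjoin_singleton_eq_range_aeval] at hmem
  obtain ⟨w, hw⟩ := hmem
  have hmu : IsUnit ((m : Algebra.adjoin A {t}) : B) := m.2
  obtain ⟨c, hc⟩ := (h.isUnit.mul hmu).exists_left_inv
  refine ⟨c * aeval t w, ?_⟩
  rw [map_mul, ← aeval_algebraMap_apply]
  have hw' : aeval (algebraMap B L t) w = aeval (algebraMap B L t)
    (derivative (minpoly K (algebraMap B L t))) * (m • z) := hw
  have hmsmul : m • z = algebraMap B L m * z := Algebra.smul_def (A := L) (m : B) z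
  rw [hw', hder, hmsmul, ← mul_assoc, ← mul_assoc, mul_assoc (algebraMap B L c), ← map_mul,
    ← map_mul, hc, map_one, one_mul]

end FractionField

/-! ### Generators over a valuation ring -/

section ValuationRing

/-- If `z` is a root of a polynomial with a unit coefficient over an integrally closed local domain,
then `z` or `z⁻¹` lies in the domain. -/
theorem mem_range_or_inv_mem_range {S L : Type*} [CommRing S] [IsLocalRing S] [IsDomain S]
    [IsIntegrallyClosed S] [Field L] [Algebra S L] [IsFractionRing S L] {z : L} (n : ℕ)
    (F : S[X]) (hn : F.natDegree ≤ n) (hF : aeval z F = 0) (hu : ∃ i, IsUnit (F.coeff i)) :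
    z ∈ (algebraMap S L).range ∨ z⁻¹ ∈ (algebraMap S L).range := by
  induction n generalizing F with
  | zero =>
    obtain ⟨i, hi⟩ := hu
    rw [eq_C_of_natDegree_le_zero hn] at hF hi
    rw [aeval_C, map_eq_zero_iff _ (IsFractionRing.injective S L)] at hF
    simp [hF] at hi
  | succ n ih =>
    obtain ⟨i, hi⟩ := hu
    by_cases hlt : F.natDegree ≤ n
    · exact ih F hlt hF ⟨i, hi⟩
    have hdeg : F.natDegree = n + 1 := by lia
    -- The leading coefficient times `z` is integral, hence is an element `c` of `S`.
    obtain ⟨c, hc⟩ := IsIntegrallyClosed.isIntegral_iff.1 (isIntegral_leadingCoeff_smul F z hF)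
    rw [leadingCoeff, hdeg, Algebra.smul_def] at hc
    by_cases ha : IsUnit (F.coeff (n + 1))
    · obtain ⟨d, hd⟩ := ha.exists_left_inv
      refine .inl ⟨d * c, ?_⟩
      rw [map_mul, hc, ← mul_assoc, ← map_mul, hd, map_one, one_mul]
    -- Replacing the leading term by `c X ^ n` keeps the root `z` and lowers the degree.
    let Q : S[X] := F.eraseLead + C c * X ^ n
    have hcoeff (k : ℕ) (hk : k < n) : Q.coeff k = F.coeff k := by
      rw [coeff_add, eraseLead_coeff_of_ne _ (by lia), coeff_C_mul_X_pow, if_neg (by lia), add_zero]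
    have hcoeffn : Q.coeff n = F.coeff n + c := by
      rw [coeff_add, eraseLead_coeff_of_ne _ (by lia), coeff_C_mul_X_pow, if_pos rfl]
    by_cases hQ : ∃ k, IsUnit (Q.coeff k)
    · refine ih Q ?_ ?_ hQ
      · refine natDegree_add_le_of_degree_le ?_ (natDegree_C_mul_X_pow_le _ _)
        exact (eraseLead_natDegree_le F).trans (by lia)
      · rw [← F.eraseLead_add_C_mul_X_pow] at hF
        simp only [map_add, map_mul, aeval_C, aeval_X_pow, leadingCoeff, hdeg] at hF
        simp only [Q, map_add, map_mul, aeval_C, aeval_X_pow, hc]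
        rw [← hF]
        ring
    -- If `Q` has lost all unit coefficients, the unit of `F` sat in degree `n` and adding `c`
    -- destroyed it. So `c` is a unit, and `z⁻¹` is the leading coefficient divided by `c`.
    · have hin : i = n := by
        by_contra hin
        rcases lt_or_gt_of_ne hin with h | h
        · exact hQ ⟨i, by rwa [hcoeff i h]⟩
        · rcases Nat.lt_or_ge (n + 1) i with h' | h'
          · rw [coeff_eq_zero_of_natDegree_lt (by lia)] at hi
            simp at hi
          · obtain rfl : i = n + 1 := by lia
            exact ha hi
      subst hin
      have hcu : IsUnit c := by
        by_contra hcu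
        refine hQ ⟨i, ?_⟩
        rw [hcoeffn]
        by_contra hsum
        have := (maximalIdeal S).sub_mem hsum hcu
        rw [add_sub_cancel_right] at this
        exact this hi
      obtain ⟨d, hd⟩ := hcu.exists_left_inv
      refine .inr ⟨d * F.coeff (i + 1), ?_⟩
      have h1 : algebraMap S L (d * F.coeff (i + 1)) * z = 1 := by
        rw [map_mul, mul_assoc, ← hc, ← map_mul, hd, map_one]
      exact eq_inv_of_mul_eq_one_left h1

/-- An element algebraic over the fraction field of a valuation ring is a root of a polynomial with
a unit coefficient. -/
theorem exists_aeval_eq_zero_coeff_eq_one {A K L : Type*} [CommRing A] [IsDomain A]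
    [ValuationRing A] [Field K] [Field L] [Algebra A K] [IsFractionRing A K] [Algebra K L]
    [Algebra A L] [IsScalarTower A K L] {z : L} (hz : IsAlgebraic K z) :
    ∃ F : A[X], aeval z F = 0 ∧ ∃ i, F.coeff i = 1 := by
  obtain ⟨F, hF0, hF⟩ := hz
  let v := ValuationRing.valuation A K
  -- Dividing by a coefficient of largest valuation makes all coefficients integral and that one
  -- equal to 1.
  obtain ⟨i, hi, hmax⟩ := Finset.exists_max_image F.support (fun k => v (F.coeff k))
    (support_nonempty.2 hF0)
  rw [mem_support_iff] at hi
  have hlift : C (F.coeff i)⁻¹ * F ∈ lifts (algebraMap A K) := by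
    rw [lifts_iff_coeff_lifts]
    intro k
    rw [coeff_C_mul]
    refine (ValuationRing.mem_integer_iff A K _).1 ?_
    rw [Valuation.mem_integer_iff, map_mul, map_inv₀]
    rcases eq_or_ne (F.coeff k) 0 with h | h
    · simp [h]
    · have h1 := hmax k (mem_support_iff.2 h)
      have h2 : v (F.coeff i) ≠ 0 := (Valuation.ne_zero_iff _).2 hi
      change (v (F.coeff i))⁻¹ * v (F.coeff k) ≤ 1
      calc _ ≤ (v (F.coeff i))⁻¹ * v (F.coeff i) := by gcongr
        _ = 1 := inv_mul_cancel₀ h2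
  obtain ⟨G, hG⟩ := hlift
  rw [coe_mapRingHom] at hG
  refine ⟨G, ?_, i, ?_⟩
  · rw [← aeval_map_algebraMap K, hG, map_mul, hF, mul_zero]
  · apply IsFractionRing.injective A K
    rw [← coeff_map, hG, coeff_C_mul, inv_mul_cancel₀ hi, map_one]

variable {A B K L : Type*} [CommRing A] [CommRing B] [Algebra A B] [Field K] [Field L]
  [Algebra A K] [Algebra B L] [Algebra K L] [Algebra A L]
  [IsScalarTower A K L] [IsScalarTower A B L] [IsDomain A] [IsFractionRing A K]

variable (K L) in
theorem fractionsAdjoin_isFractionRing [FaithfulSMul B L] {t : B}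
    (htop : Algebra.adjoin K {algebraMap B L t} = ⊤) :
    IsFractionRing (fractionsAdjoin A t) L := by
  have hSL : Function.Injective (algebraMap (fractionsAdjoin A t) L) :=
    (FaithfulSMul.algebraMap_injective B L).comp Subtype.val_injective
  have : FaithfulSMul (fractionsAdjoin A t) L :=
    (faithfulSMul_iff_algebraMap_injective _ L).2 hSL
  exact isFractionRing_of_adjoin_eq_top (A := A) K L
    (t := (⟨t, self_mem_fractionsAdjoin t⟩ : fractionsAdjoin A t)) htop

variable [IsLocalRing B] [IsDomain B]

variable (K L) in
-- Even when the fractions in `t` do not exhaust `B`, `t` is an étale generator of the ring they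
-- form, since units of `B` in that ring are units there.
theorem fractionsAdjoin_isIntegrallyClosed [IsIntegrallyClosed A] [FaithfulSMul B L] {t : B}
    (hint : IsIntegral A t) (hmem : t ∈ maximalIdeal B)
    (hunit : IsUnit (aeval t (derivative (minpoly A t))))
    (htop : Algebra.adjoin K {algebraMap B L t} = ⊤) :
    IsIntegrallyClosed (fractionsAdjoin A t) := by
  let S := fractionsAdjoin A t
  have hSB : Function.Injective (algebraMap S B) := Subtype.val_injective
  let s : S := ⟨t, self_mem_fractionsAdjoin t⟩
  have hs : algebraMap S B s = t := rfl
  have hmp : minpoly A s = minpoly A t := (minpoly.algebraMap_eq hSB s).symm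
  have := fractionsAdjoin_isFractionRing (A := A) K L htop
  have hunit' (u : A[X]) (hu : IsUnit (aeval t u)) : IsUnit (aeval s u) :=
    isUnit_of_map_unit (algebraMap S B) _ (by rwa [← aeval_algebraMap_apply])
  have hgen : IsEtaleGenerator A s := by
    refine ⟨(isIntegral_algebraMap_iff hSB).1 hint, ?_, ?_, ?_⟩
    · rw [IsLocalRing.mem_maximalIdeal, mem_nonunits_iff]
      exact fun h => hmem (h.map (algebraMap S B))
    · rw [hmp]
      exact hunit' _ hunit
    · rw [eq_top_iff]
      rintro ⟨b, u, v, hv, hb⟩ -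
      refine ⟨u, v, hunit' v hv, hSB ?_⟩
      rw [map_mul, ← aeval_algebraMap_apply, ← aeval_algebraMap_apply]
      exact hb
  exact hgen.isIntegrallyClosed K L

variable (K L) in
-- Over a valuation ring, generation is automatic. For `b` in `B`, either `b` or `b⁻¹` lies in the
-- integrally closed ring of fractions in `t`. In the second case `b⁻¹` is a unit of `B`, hence of
-- that ring, so `b` lies there as well.
theorem IsEtaleGenerator.of_valuationRing [IsIntegrallyClosed A] [ValuationRing A]
    [FaithfulSMul A B] [FaithfulSMul B L] {t : B}
    (hint : IsIntegral A t) (hmem : t ∈ maximalIdeal B)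
    (hunit : IsUnit (aeval t (derivative (minpoly A t))))
    (htop : Algebra.adjoin K {algebraMap B L t} = ⊤) : IsEtaleGenerator A t := by
  refine ⟨hint, hmem, hunit, ?_⟩
  let S := fractionsAdjoin A t
  have hBL : Function.Injective (algebraMap B L) := FaithfulSMul.algebraMap_injective B L
  have : IsFractionRing S L := fractionsAdjoin_isFractionRing K L htop
  have : IsIntegrallyClosed S := fractionsAdjoin_isIntegrallyClosed K L hint hmem hunit htop
  rw [eq_top_iff]
  rintro b -
  have halg : Algebra.IsAlgebraic K L := by
    have := finiteDimensional_of_adjoin_eq_top ((hint.algebraMap (B := L)).tower_top (A := K)) htop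
    infer_instance
  obtain ⟨F, hF, i, hi⟩ := exists_aeval_eq_zero_coeff_eq_one (A := A)
    (Algebra.IsAlgebraic.isAlgebraic (R := K) (algebraMap B L b))
  obtain ⟨c, hc⟩ | ⟨c, hc⟩ := mem_range_or_inv_mem_range (S := S) (z := algebraMap B L b) _
    (F.map (algebraMap A S)) le_rfl (by rwa [aeval_map_algebraMap])
    ⟨i, by rw [coeff_map, hi, map_one]; exact isUnit_one⟩
  · have : algebraMap S B c = b := hBL hc
    exact this ▸ c.2
  · rcases eq_or_ne b 0 with rfl | hb
    · exact zero_mem _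
    have hcb : algebraMap S B c * b = 1 := by
      apply hBL
      rw [map_mul, map_one]
      exact (congrArg (· * algebraMap B L b) hc).trans
        (inv_mul_cancel₀ ((map_ne_zero_iff _ hBL).2 hb))
    have hcu : IsUnit c := isUnit_of_map_unit (algebraMap S B) _ (IsUnit.of_mul_eq_one _ hcb)
    obtain ⟨d, hd⟩ := hcu.exists_right_inv
    have : algebraMap S B d = b := by
      have h2 : algebraMap S B c * algebraMap S B d = 1 := by rw [← map_mul, hd, map_one]
      calc _ = (algebraMap S B c * b) * algebraMap S B d := by rw [hcb, one_mul]
        _ = (algebraMap S B c * algebraMap S B d) * b := by ring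
        _ = b := by rw [h2, one_mul]
    exact this ▸ d.2

end ValuationRing

/-! ### Valuation rings dominating a local ring -/

section Dominates

/-- The valuation ring `V` of `L` dominates the local ring `B`. -/
def Dominates (B : Type*) {L : Type*} [CommRing B] [IsLocalRing B] [Field L] [Algebra B L]
    (V : ValuationSubring L) : Prop :=
  (∀ b : B, algebraMap B L b ∈ V) ∧ ∀ b ∈ maximalIdeal B, algebraMap B L b ∈ V.nonunits

section

variable {B L : Type*} [CommRing B] [IsLocalRing B] [Field L] [Algebra B L]
  {V : ValuationSubring L}

theorem Dominates.valuation_le_one (h : Dominates B V) (b : B) :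
    V.valuation (algebraMap B L b) ≤ 1 :=
  (V.valuation_le_one_iff _).2 (h.1 b)

theorem Dominates.valuation_eq_one (h : Dominates B V) {b : B} (hb : IsUnit b) :
    V.valuation (algebraMap B L b) = 1 := by
  obtain ⟨c, hc⟩ := hb.exists_right_inv
  refine le_antisymm (h.valuation_le_one b) ?_
  calc 1 = V.valuation (algebraMap B L b) * V.valuation (algebraMap B L c) := by
        rw [← map_mul, ← map_mul, hc, map_one, map_one]
    _ ≤ V.valuation (algebraMap B L b) * 1 := by
        gcongr
        exact h.valuation_le_one c
    _ = _ := mul_one _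

theorem Dominates.mem_maximalIdeal_iff (h : Dominates B V) {b : B} :
    b ∈ maximalIdeal B ↔ V.valuation (algebraMap B L b) < 1 := by
  refine ⟨fun hb => V.mem_nonunits_iff.1 (h.2 b hb), fun hb hu => ?_⟩
  exact hb.ne (h.valuation_eq_one hu)

theorem Dominates.isUnit_iff (h : Dominates B V) {b : B} :
    IsUnit b ↔ V.valuation (algebraMap B L b) = 1 := by
  refine ⟨h.valuation_eq_one, fun hb => ?_⟩
  by_contra hu
  exact (h.mem_maximalIdeal_iff.1 hu).ne hb

theorem dominates_of_valuation (h1 : ∀ b : B, V.valuation (algebraMap B L b) ≤ 1)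
    (h2 : ∀ b ∈ maximalIdeal B, V.valuation (algebraMap B L b) < 1) : Dominates B V :=
  ⟨fun b => (V.valuation_le_one_iff _).1 (h1 b), fun b hb => V.mem_nonunits_iff.2 (h2 b hb)⟩

variable (B L) in
theorem exists_dominates : ∃ V : ValuationSubring L, Dominates B V := by
  obtain ⟨V, hV, hloc⟩ := exists_factor_valuationRing (algebraMap B L)
  refine ⟨V, hV, fun b hb => ?_⟩
  rw [ValuationSubring.mem_nonunits_iff_exists_mem_maximalIdeal]
  refine ⟨hV b, fun hu => hb ?_⟩
  exact hloc.map_nonunit b hu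

end

/-- The nonunits are zero and the inverses of elements outside the ring, and membership pulls back
by definition. -/
theorem valuation_lt_one_iff_comap {K L : Type*} [Field K] [Field L] (φ : K →+* L)
    (V : ValuationSubring L) (z : K) :
    (V.comap φ).valuation z < 1 ↔ V.valuation (φ z) < 1 := by
  rcases eq_or_ne z 0 with rfl | hz
  · simp
  rw [← inv_inv z, map_inv₀, map_inv₀ φ, map_inv₀, ← ValuationSubring.mem_nonunits_iff,
    ← map_inv₀, ← map_inv₀, ← ValuationSubring.mem_nonunits_iff]
  rw [ValuationSubring.inv_mem_nonunits_iff, ValuationSubring.inv_mem_nonunits_iff]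
  simp

theorem exists_comap_eq {L M : Type*} [Field L] [Field M] (φ : L →+* M) (V : ValuationSubring L) :
    ∃ W : ValuationSubring M, W.comap φ = V := by
  let := (φ.comp (algebraMap V L)).toAlgebra
  obtain ⟨W, hW⟩ := exists_dominates V M
  refine ⟨W, ?_⟩
  ext z
  rw [ValuationSubring.mem_comap]
  refine ⟨fun hz => ?_, fun hz => hW.1 ⟨z, hz⟩⟩
  by_contra hzV
  have h1 : z⁻¹ ∈ V.nonunits := V.inv_mem_nonunits_iff.2 (.inr hzV)
  obtain ⟨h2, h3⟩ := ValuationSubring.mem_nonunits_iff_exists_mem_maximalIdeal.1 h1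
  have h4 : φ z⁻¹ ∈ W.nonunits := hW.2 _ h3
  rw [map_inv₀, W.inv_mem_nonunits_iff] at h4
  rcases h4 with h4 | h4
  · rw [map_eq_zero] at h4
    exact hzV (h4 ▸ V.zero_mem)
  · exact h4 hz

end Dominates

/-! ### From a strictly local-étale ring to the valuative condition -/

section Extends

variable {K L : Type u} [Field K] [Field L] [Algebra K L] {O : ValuationSubring K}
  {O' : ValuationSubring L}

theorem Extends.isLocalHom_ringHom (h : Extends (algebraMap K L) O O') : IsLocalHom h.ringHom where
  map_nonunit := by
    intro a ha
    rw [O.valuation_eq_one_iff]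
    refine le_antisymm ((O.valuation_le_one_iff _).2 a.2) (not_lt.1 fun hlt => ?_)
    have h1 : (O'.comap (algebraMap K L)).valuation a < 1 := by rwa [h]
    rw [valuation_lt_one_iff_comap] at h1
    exact h1.ne ((O'.valuation_eq_one_iff _).1 ha)

variable {A B : Type u} [CommRing A] [CommRing B] [Algebra A B]
  [Algebra A K] [Algebra B L] [Algebra A L]
  [IsScalarTower A K L] [IsScalarTower A B L] [IsLocalRing A] [IsLocalRing B]
  [IsDomain A] [IsIntegrallyClosed A] [IsFractionRing A K] [IsDomain B]
  [IsFractionRing B L]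

/-- The minimal polynomials of `t` over `A` and over `O` both become the one over `K`. So the value
of the derivative does not change, and domination keeps it a unit in `O'`. -/
theorem IsEtaleGenerator.of_dominates {t : B} (ht : IsEtaleGenerator A t)
    (h : Extends (algebraMap K L) O O') (hO : Dominates A O) (hO' : Dominates B O') :
    let := h.ringHom.toAlgebra
    IsEtaleGenerator O (⟨algebraMap B L t, hO'.1 t⟩ : O') := by
  intro _
  have : IsScalarTower O O' L := .of_algebraMap_eq fun _ => rfl
  have : FaithfulSMul O O' := (faithfulSMul_iff_algebraMap_injective _ _).2 fun a b hab =>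
    Subtype.ext ((algebraMap K L).injective (congrArg Subtype.val hab))
  let t' : O' := ⟨algebraMap B L t, hO'.1 t⟩
  let iA : A →+* O := (algebraMap A K).codRestrict O.toSubring hO.1
  have ht' : algebraMap O' L t' = algebraMap B L t := rfl
  have hint : IsIntegral O t' := by
    rw [← isIntegral_algebraMap_iff (B := L) Subtype.val_injective, ht']
    obtain ⟨P, hP, h0⟩ := ht.isIntegral.algebraMap (B := L)
    refine ⟨P.map iA, hP.map _, ?_⟩
    rw [eval₂_map, ← h0]
    congr 1
    ext a
    exact (IsScalarTower.algebraMap_apply A K L a).symm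
  refine IsEtaleGenerator.of_valuationRing K L hint ?_ ?_ (ht.adjoin_eq_top K L)
  · rw [O'.valuation_lt_one_iff]
    exact hO'.mem_maximalIdeal_iff.1 ht.mem_maximalIdeal
  · rw [O'.valuation_eq_one_iff]
    have h1 := aeval_derivative_minpoly_algebraMap K L hint
    rw [ht', aeval_derivative_minpoly_algebraMap K L ht.isIntegral] at h1
    exact (congrArg O'.valuation h1).symm.trans (hO'.valuation_eq_one ht.isUnit)

/-- Modulo the maximal ideal, `v(t)` is the constant term of `v`. The right-hand side no longer
involves `B`, so denominators can be compared between two extensions of the same `O`. -/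
theorem IsEtaleGenerator.isUnit_aeval_iff {A B : Type*} [CommRing A] [CommRing B] [Algebra A B]
    [IsLocalRing B] [IsLocalHom (algebraMap A B)] {t : B} (ht : IsEtaleGenerator A t) (v : A[X]) :
    IsUnit (aeval t v) ↔ IsUnit (v.coeff 0) := by
  rw [← isUnit_map_iff (algebraMap A B), ← not_iff_not, ← mem_nonunits_iff, ← mem_nonunits_iff,
    ← IsLocalRing.mem_maximalIdeal, ← IsLocalRing.mem_maximalIdeal]
  nth_rw 1 [← divX_mul_X_add v]
  simp only [map_add, map_mul, aeval_X, aeval_C]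
  exact Ideal.add_mem_iff_right _ (Ideal.mul_mem_left _ _ ht.mem_maximalIdeal)

/-- An element of `O'` is `u(t)/v(t)` with `v(0)` a unit of `O`, and the same `v(t)` is then a unit
of `O''`. -/
theorem IsEtaleGenerator.le_of_extends {t : B} (ht : IsEtaleGenerator A t)
    (h : Extends (algebraMap K L) O O') (hO : Dominates A O) (hO' : Dominates B O')
    {O'' : ValuationSubring L} (h' : Extends (algebraMap K L) O O'') (hO'' : Dominates B O'') :
    O' ≤ O'' := by
  intro z hz
  let := h.ringHom.toAlgebra
  have : IsLocalHom (algebraMap O O') := h.isLocalHom_ringHom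
  have hg : IsEtaleGenerator O (⟨algebraMap B L t, hO'.1 t⟩ : O') := ht.of_dominates h hO hO'
  have hz' : (⟨z, hz⟩ : O') ∈ fractionsAdjoin O (⟨algebraMap B L t, hO'.1 t⟩ : O') :=
    hg.eq_top ▸ trivial
  obtain ⟨u, v, hv, huv⟩ := hz'
  rw [hg.isUnit_aeval_iff] at hv
  have hval : ∀ w : O[X], ((aeval (⟨algebraMap B L t, hO'.1 t⟩ : O') w : O') : L) =
      aeval (algebraMap B L t) w := by
    intro w
    have : IsScalarTower O O' L := .of_algebraMap_eq fun _ => rfl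
    exact (aeval_algebraMap_apply L (⟨algebraMap B L t, hO'.1 t⟩ : O') w).symm
  have huv' : z * aeval (algebraMap B L t) v = aeval (algebraMap B L t) u := by
    rw [← hval, ← hval, ← huv]
    rfl
  let := h'.ringHom.toAlgebra
  have : IsLocalHom (algebraMap O O'') := h'.isLocalHom_ringHom
  have hg' : IsEtaleGenerator O (⟨algebraMap B L t, hO''.1 t⟩ : O'') := ht.of_dominates h' hO hO''
  rw [← hg'.isUnit_aeval_iff, O''.valuation_eq_one_iff] at hv
  have hval' : ∀ w : O[X], ((aeval (⟨algebraMap B L t, hO''.1 t⟩ : O'') w : O'') : L) =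
      aeval (algebraMap B L t) w := by
    intro w
    have : IsScalarTower O O'' L := .of_algebraMap_eq fun _ => rfl
    exact (aeval_algebraMap_apply L (⟨algebraMap B L t, hO''.1 t⟩ : O'') w).symm
  rw [hval'] at hv
  rw [← O''.valuation_le_one_iff]
  calc O''.valuation z = O''.valuation (z * aeval (algebraMap B L t) v) := by
        rw [map_mul, hv, mul_one]
    _ ≤ 1 := by
        rw [huv', ← hval']
        exact (O''.valuation_le_one_iff _).2 (Subtype.mem _)

variable (K L) in
/-- If `B` is strictly local-étale over `A`, then every valuation ring dominating `B` is the unique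
extension dominating `B` of its restriction, and is strictly local-étale over it. -/
theorem IsEtaleGenerator.exists_valuationSubring [IsLocalHom (algebraMap A B)] {t : B}
    (ht : IsEtaleGenerator A t) :
    ∃ O : ValuationSubring K, Dominates A O ∧ ∃ O' : ValuationSubring L,
      ∃ h : Extends (algebraMap K L) O O', Dominates B O' ∧
        (∀ O'' : ValuationSubring L, Extends (algebraMap K L) O O'' → Dominates B O'' →
          O'' = O') ∧ IsStrictlyLocalEtale h.ringHom := by
  obtain ⟨O', hO'⟩ := exists_dominates B L
  have hO : Dominates A (O'.comap (algebraMap K L)) := by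
    refine ⟨fun a => ?_, fun a ha => ?_⟩
    · rw [ValuationSubring.mem_comap, ← IsScalarTower.algebraMap_apply,
        IsScalarTower.algebraMap_apply A B L]
      exact hO'.1 _
    · rw [ValuationSubring.mem_nonunits_iff, valuation_lt_one_iff_comap,
        ← IsScalarTower.algebraMap_apply, IsScalarTower.algebraMap_apply A B L,
        ← hO'.mem_maximalIdeal_iff]
      exact fun hu => ha (isUnit_of_map_unit (algebraMap A B) a hu)
  have h : Extends (algebraMap K L) (O'.comap (algebraMap K L)) O' := rfl
  refine ⟨_, hO, O', h, hO', fun O'' h'' hO'' => le_antisymm ?_ ?_, ?_⟩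
  · exact ht.le_of_extends h'' hO hO'' h hO'
  · exact ht.le_of_extends h hO hO' h'' hO''
  · let := h.ringHom.toAlgebra
    have : IsLocalHom (algebraMap (O'.comap (algebraMap K L)) O') := h.isLocalHom_ringHom
    have : FaithfulSMul (O'.comap (algebraMap K L)) O' :=
      (faithfulSMul_iff_algebraMap_injective _ _).2 fun a b hab =>
        Subtype.ext ((algebraMap K L).injective (congrArg Subtype.val hab))
    exact (ht.of_dominates h hO hO').isStrictlyLocalEtale

end Extends

/-! ### From the valuative condition to an étale generator -/

section Criterion

theorem intermediateField_adjoin_eq_top {K L : Type*} [Field K] [Field L] [Algebra K L] {s : L}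
    (h : Algebra.adjoin K {s} = ⊤) : IntermediateField.adjoin K {s} = ⊤ := by
  rw [eq_top_iff]
  rintro x -
  exact IntermediateField.algebra_adjoin_le_adjoin K {s} (h ▸ Algebra.mem_top)

theorem valuation_le_one_of_isIntegral {A M : Type*} [CommRing A] [Field M] [Algebra A M]
    (W : ValuationSubring M) (hA : ∀ a : A, algebraMap A M a ∈ W) {z : M} (hz : IsIntegral A z) :
    W.valuation z ≤ 1 := by
  rw [W.valuation_le_one_iff]
  have hz' : IsIntegral W z := by
    obtain ⟨P, hP, h0⟩ := hz
    refine ⟨P.map ((algebraMap A M).codRestrict W.toSubring hA), hP.map _, ?_⟩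
    rw [eval₂_map, ← h0]
    rfl
  obtain ⟨w, rfl⟩ := IsIntegrallyClosed.isIntegral_iff.1 hz'
  exact w.2

theorem algHom_eq_of_adjoin_eq_top {K L M : Type*} [Field K] [Field L] [Field M] [Algebra K L]
    [Algebra K M] {s : L} (h : Algebra.adjoin K {s} = ⊤) {σ τ : L →ₐ[K] M} (hs : σ s = τ s) :
    σ = τ :=
  AlgHom.ext_of_adjoin_eq_top h (by rintro _ rfl; exact hs)

/-- A conjugate of a local-étale generator which is not a unit is equal to the generator. -/
theorem algHom_eq_of_valuation_lt_one {K L M : Type*} [Field K] [Field L] [Field M] [Algebra K L]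
    [Algebra K M] {O : ValuationSubring K} {W : ValuationSubring M} {σ τ : L →ₐ[K] M} {s : L}
    (hO : ∀ a ∈ O, algebraMap K M a ∈ W) {P : O[X]} (hP : aeval s P = 0)
    (hP' : W.valuation (τ (aeval s (derivative P))) = 1)
    (hσ : W.valuation (σ s) < 1) (hτ : W.valuation (τ s) < 1) : σ s = τ s := by
  let i : O →+* W := (algebraMap K M).restrict O W hO
  let x : W := ⟨σ s, (W.valuation_le_one_iff _).1 hσ.le⟩
  let y : W := ⟨τ s, (W.valuation_le_one_iff _).1 hτ.le⟩
  have hev (φ : L →ₐ[K] M) (hφ : φ s ∈ W) (Q : O[X]) :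
      ((eval (⟨φ s, hφ⟩ : W) (Q.map i) : W) : M) = φ (aeval s Q) := by
    have h1 : (W.subtype.comp i) = (φ : L →+* M).comp (algebraMap O L) := by
      ext a
      exact (φ.commutes a.1).symm
    have h2 := hom_eval₂ Q i W.subtype (⟨φ s, hφ⟩ : W)
    rw [h1] at h2
    rw [Polynomial.eval_map]
    refine h2.trans ?_
    exact (hom_eval₂ Q (algebraMap O L) (φ : L →+* M) s).symm
  -- Uniqueness in Hensel's lemma: Taylor expansion at `y` gives `0 = (P'(y) + k (x - y)) (x - y)`.
  -- The first factor is a unit because `x` and `y` lie in the maximal ideal.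
  obtain ⟨k, hk⟩ := binomExpansion (P.map i) y (x - y)
  rw [add_sub_cancel] at hk
  have hx0 : eval x (P.map i) = 0 := Subtype.ext (by rw [hev σ, hP, map_zero]; rfl)
  have hy0 : eval y (P.map i) = 0 := Subtype.ext (by rw [hev τ, hP, map_zero]; rfl)
  have hu : IsUnit (eval y (derivative (P.map i))) := by
    rw [derivative_map, W.valuation_eq_one_iff, hev τ]
    exact hP'
  have hxm : x ∈ maximalIdeal W := (W.valuation_lt_one_iff x).2 hσ
  have hym : y ∈ maximalIdeal W := (W.valuation_lt_one_iff y).2 hτ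
  have hunit : IsUnit (eval y (derivative (P.map i)) + k * (x - y)) := by
    by_contra hn
    have := (maximalIdeal W).sub_mem hn
      ((maximalIdeal W).mul_mem_left k ((maximalIdeal W).sub_mem hxm hym))
    rw [add_sub_cancel_right] at this
    exact this hu
  have hmul : (eval y (derivative (P.map i)) + k * (x - y)) * (x - y) = 0 := by
    rw [hx0, hy0] at hk
    rw [hk]
    ring
  have := (hunit.mul_right_eq_zero).1 hmul
  exact congrArg Subtype.val (sub_eq_zero.1 this)

/-- If `c` has valuation one and its other conjugates have valuation less than one, then the
derivative of the minimal polynomial of `c` has valuation one at `c`. -/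
theorem valuation_aeval_derivative_minpoly {K L M : Type*} [Field K] [Field L] [Field M]
    [Algebra K L] [Algebra K M] [Algebra.IsAlgebraic K L] [Algebra.IsSeparable K L] [IsAlgClosed M]
    (W : ValuationSubring M) (τ : L →ₐ[K] M) {c : L} (hτ : W.valuation (τ c) = 1)
    (hσ : ∀ σ : L →ₐ[K] M, σ ≠ τ → W.valuation (σ c) < 1) :
    W.valuation (τ (aeval c (derivative (minpoly K c)))) = 1 := by
  classical
  have hint : IsIntegral K c := Algebra.IsIntegral.isIntegral c
  have hsplit := IsAlgClosed.splits ((minpoly K c).map (algebraMap K M))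
  have hroot : τ c ∈ ((minpoly K c).map (algebraMap K M)).roots := by
    rw [mem_roots ((minpoly.monic hint).map _).ne_zero, IsRoot, eval_map_algebraMap,
      aeval_algHom_apply, minpoly.aeval, map_zero]
  have hnodup : ((minpoly K c).map (algebraMap K M)).roots.Nodup :=
    nodup_roots (Separable.map (Algebra.IsSeparable.isSeparable K c))
  -- At the simple root `τ c` the derivative is the product of the differences to the other roots.
  -- Each difference has valuation one, since `τ c` dominates.
  rw [← aeval_algHom_apply, ← eval_map_algebraMap, ← derivative_map,
    hsplit.eval_root_derivative ((minpoly.monic hint).map _) hroot, map_multiset_prod,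
    Multiset.map_map]
  refine Multiset.prod_eq_one fun v hv => ?_
  obtain ⟨a, ha, rfl⟩ := Multiset.mem_map.1 hv
  rw [hnodup.mem_erase_iff] at ha
  have hmem : a ∈ (minpoly K c).rootSet M := by
    classical
    rw [rootSet_def]
    simpa [aroots_def] using ha.2
  rw [← Algebra.IsAlgebraic.range_eval_eq_rootSet_minpoly] at hmem
  obtain ⟨σ, rfl⟩ := hmem
  have hlt : W.valuation (σ c) < 1 := hσ σ (by rintro rfl; exact ha.1 rfl)
  simp only [Function.comp_apply]
  rw [Valuation.map_sub_eq_of_lt_left _ (by rwa [hτ]), hτ]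

variable {K L : Type u} [Field K] [Field L] [Algebra K L] {A B : Type u} [CommRing A] [CommRing B]
  [Algebra A B] [Algebra A K] [Algebra B L] [Algebra A L]
  [IsScalarTower A K L] [IsScalarTower A B L] [IsLocalRing B]
  [IsDomain A] [IsIntegrallyClosed A] [IsFractionRing A K] [IsDomain B] [FaithfulSMul A B]
  [IsFractionRing B L]

/-- An element `c ≡ 1` of `B` whose conjugates are nonunits gives a generator of `B`. -/
theorem isEtaleGenerator_sub_one
    (hB : ∀ b : B, ∃ d e : B, IsIntegral A d ∧ IsIntegral A e ∧ IsUnit e ∧ b * e = d)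
    {c : B} (hc : IsIntegral A c) (hc1 : c - 1 ∈ maximalIdeal B)
    (hunit : IsUnit (aeval c (derivative (minpoly A c))))
    (htop : Algebra.adjoin K {algebraMap B L c} = ⊤) : IsEtaleGenerator A (c - 1) := by
  have hev (u : A[X]) : aeval (c - 1) (u.comp (X + C 1)) = aeval c u := by
    rw [aeval_comp]
    simp
  have hint : IsIntegral A (c - 1) := hc.sub isIntegral_one
  have hunit' : IsUnit (aeval (c - 1) (derivative (minpoly A (c - 1)))) := by
    refine isUnit_aeval_derivative_minpoly (F := (minpoly A c).comp (X + C 1)) hint ?_ ?_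
    · rw [hev, minpoly.aeval]
    · have : derivative ((minpoly A c).comp (X + C 1)) =
          (derivative (minpoly A c)).comp (X + C 1) := by
        simp [derivative_comp]
      rw [this, hev]
      exact hunit
  have htop' : Algebra.adjoin K {algebraMap B L (c - 1)} = ⊤ := by
    rw [eq_top_iff, ← htop]
    refine Algebra.adjoin_le ?_
    rintro _ rfl
    have := add_mem (Algebra.self_mem_adjoin_singleton K (algebraMap B L (c - 1)))
      (one_mem (Algebra.adjoin K {algebraMap B L (c - 1)}))
    simpa using this
  refine ⟨hint, hc1, hunit', ?_⟩
  have : IsFractionRing (fractionsAdjoin A (c - 1)) L := fractionsAdjoin_isFractionRing K L htop'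
  have : IsIntegrallyClosed (fractionsAdjoin A (c - 1)) :=
    fractionsAdjoin_isIntegrallyClosed K L hint hc1 hunit' htop'
  -- The ring of fractions is integrally closed in `L`, so it contains the numerators and
  -- denominators provided by `hB`.
  have hmem (d : B) (hd : IsIntegral A d) : d ∈ fractionsAdjoin A (c - 1) := by
    have h1 : IsIntegral (fractionsAdjoin A (c - 1)) (algebraMap B L d) :=
      (hd.algebraMap (B := L)).tower_top
    obtain ⟨s, hs⟩ := IsIntegrallyClosed.isIntegral_iff.1 h1
    have : algebraMap (fractionsAdjoin A (c - 1)) B s = d := IsFractionRing.injective B L hs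
    exact this ▸ s.2
  rw [eq_top_iff]
  rintro b -
  obtain ⟨d, e, hd, he, hu, rfl⟩ := hB b
  obtain ⟨f, hf⟩ := (isUnit_of_map_unit (algebraMap (fractionsAdjoin A (c - 1)) B)
    ⟨e, hmem e he⟩ hu).exists_right_inv
  have hf' : e * (f : B) = 1 := congrArg Subtype.val hf
  have := mul_mem (hmem _ hd) f.2
  rwa [mul_assoc, hf', mul_one] at this

/-- The generator `s` of `O'` over `O` need not lie in `B`. It only makes `L` finite separable over
`K` and tells the embeddings of `L` apart. The generator of `B` is built anew by separating maximal
ideals of the integral closure. -/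
theorem exists_isEtaleGenerator_of_extends [IsLocalRing A] [IsLocalHom (algebraMap A B)]
    (hB : ∀ b : B, ∃ d e : B, IsIntegral A d ∧ IsIntegral A e ∧ IsUnit e ∧ b * e = d)
    {O : ValuationSubring K} {O' : ValuationSubring L} (hO : Dominates A O)
    (h : Extends (algebraMap K L) O O') (hO' : Dominates B O')
    (huniq : ∀ O'' : ValuationSubring L, Extends (algebraMap K L) O O'' → Dominates B O'' →
      O'' = O')
    (het : IsStrictlyLocalEtale h.ringHom) : ∃ t : B, IsEtaleGenerator A t := by
  obtain ⟨s, hsmem, P, hP, hP', hsgen⟩ : ∃ s : L, O'.valuation s < 1 ∧ ∃ P : O[X], aeval s P = 0 ∧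
      O'.valuation (aeval s (derivative P)) = 1 ∧ Algebra.adjoin K {s} = ⊤ ∧
      IsSeparable K s ∧ IsIntegral K s := by
    let := h.ringHom.toAlgebra
    have : IsScalarTower O O' L := .of_algebraMap_eq fun _ => rfl
    have : FaithfulSMul O O' := (faithfulSMul_iff_algebraMap_injective _ _).2 fun a b hab =>
      Subtype.ext ((algebraMap K L).injective (congrArg Subtype.val hab))
    obtain ⟨s, hs⟩ := IsStrictlyLocalEtale.exists_isEtaleGenerator (A := O) (B := O') het
    have hint : IsIntegral K (algebraMap O' L s) := (hs.isIntegral.algebraMap (B := L)).tower_top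
    refine ⟨algebraMap O' L s, (O'.valuation_lt_one_iff s).1 hs.mem_maximalIdeal, minpoly O s, ?_,
      ?_, hs.adjoin_eq_top K L, ?_, hint⟩
    · rw [aeval_algebraMap_apply, minpoly.aeval, map_zero]
    · rw [aeval_algebraMap_apply]
      exact (O'.valuation_eq_one_iff _).1 hs.isUnit
    · refine isSeparable_of_aeval_derivative_ne_zero hint ?_
      rw [aeval_derivative_minpoly_algebraMap K L hs.isIntegral]
      exact (hs.isUnit.map _).ne_zero
  obtain ⟨hsgen, hsep, hsint⟩ := hsgen
  have hfin : FiniteDimensional K L := finiteDimensional_of_adjoin_eq_top hsint hsgen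
  have hsepL : Algebra.IsSeparable K L := by
    have := (IntermediateField.isSeparable_adjoin_simple_iff_isSeparable K L).2 hsep
    rw [intermediateField_adjoin_eq_top hsgen] at this
    exact (AlgEquiv.Algebra.isSeparable_iff (IntermediateField.topEquiv (F := K) (E := L))).1 this
  let M := AlgebraicClosure L
  obtain ⟨W, hW⟩ := exists_comap_eq (algebraMap L M) O'
  let τ : L →ₐ[K] M := IsScalarTower.toAlgHom K L M
  have hτcomap : W.comap (τ : L →+* M) = O' := hW
  have hτlt (z : L) : W.valuation (τ z) < 1 ↔ O'.valuation z < 1 := by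
    rw [← hτcomap, valuation_lt_one_iff_comap]
    rfl
  have hτle (z : L) : W.valuation (τ z) ≤ 1 ↔ O'.valuation z ≤ 1 := by
    rw [← hτcomap, ValuationSubring.valuation_le_one_iff, ValuationSubring.valuation_le_one_iff]
    rfl
  have hτeq (z : L) : W.valuation (τ z) = 1 ↔ O'.valuation z = 1 := by
    rw [eq_iff_le_not_lt, eq_iff_le_not_lt, hτlt, hτle]
  have hOW : ∀ a ∈ O, algebraMap K M a ∈ W := by
    intro a ha
    rw [← W.valuation_le_one_iff, ← τ.commutes, hτle, O'.valuation_le_one_iff]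
    rw [← h] at ha
    exact ha
  have hext (σ : L →ₐ[K] M) : Extends (algebraMap K L) O (W.comap (σ : L →+* M)) := by
    have h1 : Extends (algebraMap K L) O (W.comap (τ : L →+* M)) := by rwa [hτcomap]
    rw [Extends, ValuationSubring.comap_comap, AlgHom.comp_algebraMap] at h1 ⊢
    exact h1
  -- Otherwise uniqueness gives `O'` as the pullback along `σ`. Then `σ s` and `τ s` are both roots
  -- of `P` in the maximal ideal of `W`, so they coincide.
  have hne (σ : L →ₐ[K] M) (hσ : σ ≠ τ) : ¬ Dominates B (W.comap (σ : L →+* M)) := by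
    intro hdom
    have hcomap := huniq _ (hext σ) hdom
    refine hσ (algHom_eq_of_adjoin_eq_top hsgen
      (algHom_eq_of_valuation_lt_one hOW hP ((hτeq _).2 hP') ?_ ((hτlt _).2 hsmem)))
    have h1 := valuation_lt_one_iff_comap (σ : L →+* M) W s
    rw [hcomap] at h1
    exact h1.1 hsmem
  let D := integralClosure A B
  have hDle (σ : L →ₐ[K] M) (d : D) : W.valuation (σ (algebraMap B L d)) ≤ 1 := by
    have hd : IsIntegral A (algebraMap B L d) := IsIntegral.algebraMap d.2
    have hd' := hd.map (σ.restrictScalars A)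
    refine valuation_le_one_of_isIntegral W (fun a => ?_) hd'
    rw [IsScalarTower.algebraMap_apply A K M]
    exact hOW _ (hO.1 a)
  let ev (σ : L →ₐ[K] M) : D →+* W :=
    (((σ : L →+* M).comp (algebraMap B L)).comp (algebraMap D B)).codRestrict W.toSubring
      fun d => (W.valuation_le_one_iff _).1 (hDle σ d)
  let n (σ : L →ₐ[K] M) : Ideal D := (maximalIdeal W).comap (ev σ)
  have hn (σ : L →ₐ[K] M) (d : D) : d ∈ n σ ↔ W.valuation (σ (algebraMap B L d)) < 1 :=
    W.valuation_lt_one_iff _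
  have hnτ (d : D) : d ∈ n τ ↔ (d : B) ∈ maximalIdeal B := by
    rw [hn, hτlt, hO'.mem_maximalIdeal_iff]
  have hprime (σ : L →ₐ[K] M) : (n σ).IsPrime := inferInstance
  -- `D` is integral over `A`, and `n σ` lies over the maximal ideal of `A`.
  have hmax (σ : L →ₐ[K] M) : (n σ).IsMaximal := by
    refine Ideal.isMaximal_of_isIntegral_of_isMaximal_comap (R := A) _ ?_
    convert maximalIdeal.isMaximal A
    ext a
    rw [Ideal.mem_comap, hn, hO.mem_maximalIdeal_iff]
    have h1 : σ (algebraMap B L (algebraMap A D a : D)) =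
        σ (algebraMap K L (algebraMap A K a)) := by
      rw [← IsScalarTower.algebraMap_apply A K L, IsScalarTower.algebraMap_apply A B L]
      rfl
    rw [h1]
    have h2 := valuation_lt_one_iff_comap (algebraMap K L) (W.comap (σ : L →+* M))
      (algebraMap A K a)
    rw [hext σ, valuation_lt_one_iff_comap] at h2
    exact h2.symm
  -- An inclusion would be an equality. Denominators that are units in `B` would then have valuation
  -- one under `σ`, and the pullback of `W` along `σ` would dominate `B`.
  have hnle (σ : L →ₐ[K] M) (hσ : σ ≠ τ) : ¬ n σ ≤ n τ := by
    intro hle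
    have heq : n σ = n τ := (hmax σ).eq_of_le (hprime τ).ne_top hle
    have hnσ (d : B) (hd : IsIntegral A d) :
        W.valuation (σ (algebraMap B L d)) < 1 ↔ d ∈ maximalIdeal B := by
      rw [← hnτ ⟨d, hd⟩, ← heq, hn]
    have hval (d e b : B) (hde : b * e = d) (he : IsIntegral A e) (hu : IsUnit e) :
        W.valuation (σ (algebraMap B L b)) = W.valuation (σ (algebraMap B L d)) := by
      have h1 : W.valuation (σ (algebraMap B L e)) = 1 := by
        refine le_antisymm (hDle σ ⟨e, he⟩) (not_lt.1 fun hlt => ?_)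
        exact (hnσ e he).1 hlt hu
      rw [← hde, map_mul, map_mul, map_mul, h1, mul_one]
    refine hne σ hσ (dominates_of_valuation (fun b => ?_) fun b hb => ?_)
    · obtain ⟨d, e, hd, he, hu, hde⟩ := hB b
      rw [ValuationSubring.valuation_le_one_iff, ValuationSubring.mem_comap,
        ← ValuationSubring.valuation_le_one_iff]
      exact (hval d e b hde he hu).trans_le (hDle σ ⟨d, hd⟩)
    · obtain ⟨d, e, hd, he, hu, hde⟩ := hB b
      rw [valuation_lt_one_iff_comap]
      refine (hval d e b hde he hu).trans_lt ((hnσ d hd).2 ?_)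
      rw [← hde]
      exact Ideal.mul_mem_right _ _ hb
  -- There are finitely many embeddings and `n τ` is prime, so some element of all the other `n σ`
  -- avoids `n τ`. It is then normalized to be 1 modulo `n τ`.
  obtain ⟨c, hc1, hcσ⟩ : ∃ c : D, c - 1 ∈ n τ ∧ ∀ σ : L →ₐ[K] M, σ ≠ τ → c ∈ n σ := by
    classical
    have := Fintype.ofFinite (L →ₐ[K] M)
    have h1 : ¬ (Finset.univ.erase τ).inf n ≤ n τ := by
      rw [(hprime τ).inf_le']
      rintro ⟨σ, hσ, hle⟩
      exact hnle σ (Finset.ne_of_mem_erase hσ) hle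
    obtain ⟨a, ha, haτ⟩ := Set.not_subset.1 h1
    obtain ⟨y, i, hi, hyi⟩ := (hmax τ).exists_inv haτ
    refine ⟨y * a, ?_, fun σ hσ => Ideal.mul_mem_left _ _ ?_⟩
    · rw [← hyi, sub_add_cancel_left]
      exact (n τ).neg_mem hi
    · exact Finset.inf_le (f := n) (Finset.mem_erase.2 ⟨hσ, Finset.mem_univ σ⟩) ha
  have hτc : W.valuation (τ (algebraMap B L c)) = 1 := by
    refine le_antisymm (hDle τ c) (not_lt.1 fun hlt => ?_)
    refine (hprime τ).ne_top ((Ideal.eq_top_iff_one _).2 ?_)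
    have := (n τ).sub_mem ((hn τ c).2 hlt) hc1
    rwa [sub_sub_cancel] at this
  have hσc (σ : L →ₐ[K] M) (hσ : σ ≠ τ) : W.valuation (σ (algebraMap B L c)) < 1 :=
    (hn σ c).1 (hcσ σ hσ)
  refine ⟨(c : B) - 1, isEtaleGenerator_sub_one (K := K) (L := L) hB c.2 ((hnτ _).1 hc1) ?_ ?_⟩
  · have h1 := valuation_aeval_derivative_minpoly W τ hτc hσc
    rwa [aeval_derivative_minpoly_algebraMap K L c.2, hτeq, ← hO'.isUnit_iff] at h1
  -- Only `τ` gives `c` valuation one, so no other embedding agrees with `τ` at `c`, and `c` is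
  -- primitive.
  · have halg : IsAlgebraic K (algebraMap B L c) := Algebra.IsAlgebraic.isAlgebraic _
    rw [← IntermediateField.adjoin_simple_toSubalgebra_of_isAlgebraic halg,
      (Field.primitive_element_iff_algHom_eq_of_eval K M (fun x => IsAlgClosed.splits _) _ τ).2,
      IntermediateField.top_toSubalgebra]
    intro σ hσ
    by_contra hne'
    exact (hσc σ (Ne.symm hne')).ne (hσ ▸ hτc)

end Criterion

/-! ### Zariski's main theorem beyond finite type -/

section ZariskiMain

/-- Scale the roots of an integral equation by a power of `r` that makes every coefficient integral
over `R`. Each nonleading coefficient receives at least one such factor. -/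
theorem exists_isIntegral_pow_mul_of_isIntegral {R C₁ C : Type*} [CommRing R] [CommRing C₁]
    [CommRing C] [Nontrivial C] [Algebra R C₁] [Algebra C₁ C] [Algebra R C] [IsScalarTower R C₁ C]
    {r : C₁} (hr : IsIntegral R r) (h : ∀ x : C₁, ∃ m : ℕ, IsIntegral R (r ^ m * x)) {c : C}
    (hc : IsIntegral C₁ c) : ∃ m : ℕ, IsIntegral R (algebraMap C₁ C r ^ m * c) := by
  obtain ⟨P, hP, h0⟩ := hc
  choose m hm using h
  let N := P.support.sup fun i => m (P.coeff i)
  have hN (i : ℕ) : IsIntegral R (r ^ N * P.coeff i) := by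
    by_cases hi : i ∈ P.support
    · have hle : m (P.coeff i) ≤ N := Finset.le_sup (f := fun i => m (P.coeff i)) hi
      rw [← Nat.sub_add_cancel hle, pow_add, mul_assoc]
      exact (hr.pow _).mul (hm _)
    · rw [notMem_support_iff.1 hi, mul_zero]
      exact isIntegral_zero
  have hdeg : P.natDegree ≠ 0 := by
    intro hd
    rw [hP.natDegree_eq_zero] at hd
    simp [hd] at h0
  have hmon : ((P.scaleRoots (r ^ N)).map (algebraMap C₁ C)).Monic :=
    ((monic_scaleRoots_iff _).2 hP).map _
  refine ⟨N, IsIntegral.of_aeval_monic_of_isIntegral_coeff hmon ?_ ?_ fun i => ?_⟩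
  · rw [((monic_scaleRoots_iff _).2 hP).natDegree_map, natDegree_scaleRoots]
    exact hdeg
  · rw [Polynomial.eval_map, ← map_pow, scaleRoots_eval₂_eq_zero _ h0]
    exact isIntegral_zero
  · rw [coeff_map, coeff_scaleRoots]
    refine IsIntegral.algebraMap ?_
    by_cases hi : i < P.natDegree
    · obtain ⟨k, hk⟩ := Nat.exists_eq_add_of_lt hi
      have : P.natDegree - i = k + 1 := by lia
      rw [this, pow_succ, mul_left_comm, mul_comm (P.coeff i)]
      exact ((hr.pow _).pow _).mul (hN i)
    · have : P.natDegree - i = 0 := by lia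
      rw [this, pow_zero, mul_one]
      rcases (not_lt.1 hi).eq_or_lt with h | h
      · rw [← h, hP.coeff_natDegree]
        exact isIntegral_one
      · rw [coeff_eq_zero_of_natDegree_lt h]
        exact isIntegral_zero

/-- Zariski's main theorem for algebras which are integral over an algebra of finite type. -/
theorem exists_isIntegral_mul_eq_of_isolated {R C₀ C B : Type*} [CommRing R] [CommRing C₀]
    [CommRing C] [CommRing B] [Algebra R C₀] [Algebra C₀ C] [Algebra R C] [IsScalarTower R C₀ C]
    [Algebra.FiniteType R C₀] [Algebra.IsIntegral C₀ C] [Algebra C B] [Algebra R B]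
    [IsScalarTower R C B] (q : Ideal C) [q.IsPrime] [IsLocalization.AtPrime B q] {s : C}
    (hs : s ∉ q)
    (hq : ∀ q' : Ideal C, q'.IsPrime → s ∉ q' → q'.comap (algebraMap R C) =
      q.comap (algebraMap R C) → q' = q) (b : B) :
    ∃ d e : B, IsIntegral R d ∧ IsIntegral R e ∧ IsUnit e ∧ b * e = d := by
  let Cs := Localization.Away s
  have hdisj : Disjoint (Submonoid.powers s : Set C) q := by
    rw [Set.disjoint_left]
    rintro _ ⟨n, rfl⟩ hn
    exact hs (Ideal.IsPrime.mem_of_pow_mem ‹_› n hn)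
  let qs : Ideal Cs := q.map (algebraMap C Cs)
  have hqs : qs.IsPrime := IsLocalization.isPrime_of_isPrime_disjoint (.powers s) Cs q ‹_› hdisj
  have hqsc : qs.comap (algebraMap C Cs) = q :=
    IsLocalization.under_map_of_isPrime_disjoint (.powers s) Cs ‹_› hdisj
  have : Nontrivial Cs := ⟨⟨0, 1, fun h => hqs.ne_top ((Ideal.eq_top_iff_one _).2
    (h ▸ qs.zero_mem))⟩⟩
  let si : Cs := IsLocalization.Away.invSelf s
  have hsi : algebraMap C Cs s * si = 1 := IsLocalization.Away.mul_invSelf s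
  -- The usual theorem needs finite type, which `C` may lack. `C₁` is of finite type over `R`, and
  -- having `1/s` in it makes `Cs` integral over it.
  let C₁ : Subalgebra C₀ Cs := Algebra.adjoin C₀ {algebraMap C Cs s, si}
  have hft : Algebra.FiniteType C₀ C₁ :=
    (Subalgebra.fg_iff_finiteType _).1 (Subalgebra.fg_def.2 ⟨_, Set.toFinite _, rfl⟩)
  have : Algebra.FiniteType R C₁ := .trans (S := C₀) ‹_› ‹_›
  have hC (c : C) : IsIntegral C₁ (algebraMap C Cs c) :=
    ((Algebra.IsIntegral.isIntegral (R := C₀) c).algebraMap (B := Cs)).tower_top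
  have hint : Algebra.IsIntegral C₁ Cs := by
    refine ⟨fun z => ?_⟩
    obtain ⟨⟨c, ⟨_, n, rfl⟩⟩, hz⟩ := IsLocalization.surj (.powers s) z
    have hz' : z = algebraMap C Cs c * si ^ n := by
      rw [← hz, mul_assoc]
      simp only [map_pow]
      rw [← mul_pow, hsi, one_pow, mul_one]
    rw [hz']
    have hsi1 : si ∈ C₁ := Algebra.subset_adjoin (by simp)
    exact (hC c).mul ((isIntegral_algebraMap (x := (⟨si, hsi1⟩ : C₁))).pow n)
  let q₁ : PrimeSpectrum C₁ := ⟨qs.comap (algebraMap C₁ Cs), inferInstance⟩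
  -- Lying over for the integral extension `Cs` of `C₁` lifts `q'` to a prime of `Cs`, where
  -- isolation of `q` applies.
  have huniq (q' : PrimeSpectrum C₁)
      (h : q'.comap (algebraMap R C₁) = q₁.comap (algebraMap R C₁)) : q' = q₁ := by
    obtain ⟨Q, -, hQ, hQq⟩ := Ideal.exists_ideal_over_prime_of_isIntegral q'.asIdeal (⊥ : Ideal Cs)
      (by
        have : Function.Injective (algebraMap C₁ Cs) := Subtype.val_injective
        rw [← RingHom.ker_eq_comap_bot, (RingHom.injective_iff_ker_eq_bot _).1 this]
        exact bot_le)
    have h1 : (Q.comap (algebraMap C Cs)) = q := by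
      refine hq _ inferInstance (fun hmem => ?_) ?_
      · refine hQ.ne_top ((Ideal.eq_top_iff_one _).2 ?_)
        rw [← hsi]
        exact Q.mul_mem_right _ hmem
      · have h2 := congrArg PrimeSpectrum.asIdeal h
        simp only [PrimeSpectrum.comap_asIdeal, ← hQq, q₁, Ideal.comap_comap,
          ← IsScalarTower.algebraMap_eq] at h2
        rw [Ideal.comap_comap, ← IsScalarTower.algebraMap_eq, h2]
        conv_rhs => rw [← hqsc]
        rw [Ideal.comap_comap, ← IsScalarTower.algebraMap_eq]
    have h2 : Q = qs :=
      (IsLocalization.map_under (.powers s) Cs Q).symm.trans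
        (congrArg (Ideal.map (algebraMap C Cs)) h1)
    refine PrimeSpectrum.ext ?_
    rw [← hQq, h2]
  have hqf : Algebra.QuasiFiniteAt R q₁.asIdeal := by
    refine Algebra.QuasiFiniteAt.of_isOpen_singleton_fiber q₁ ?_
    convert isOpen_univ
    rw [Set.eq_univ_iff_forall]
    rintro ⟨q', hq'⟩
    exact Subtype.ext (huniq q' hq')
  obtain ⟨r, hr, hrint, hrm⟩ := Algebra.zariskisMainProperty_iff.1
    (Algebra.ZariskisMainProperty.of_finiteType (R := R) q₁.asIdeal)
  let l : Cs →ₐ[C] B := IsLocalization.Away.liftAlgHom s (f := Algebra.ofId C B)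
    (IsLocalization.map_units B (⟨s, hs⟩ : q.primeCompl))
  have hl (c : C) : l (algebraMap C Cs c) = algebraMap C B c := l.commutes c
  have hru : IsUnit (l r) := by
    obtain ⟨⟨c, ⟨_, n, rfl⟩⟩, hz⟩ := IsLocalization.surj (.powers s) (r : Cs)
    have hc : c ∉ q := by
      intro hc
      have h1 : algebraMap C Cs c ∈ qs := Ideal.mem_map_of_mem _ hc
      rw [← hz] at h1
      rcases hqs.mem_or_mem h1 with h2 | h2
      · exact hr h2
      · exact hs (hqs.mem_of_pow_mem n (by simpa using h2) |> fun h3 => by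
          rw [← hqsc]
          exact h3)
    have h1 := congrArg l hz
    rw [map_mul, hl, hl] at h1
    exact isUnit_of_mul_isUnit_left (h1 ▸ IsLocalization.map_units B (⟨c, hc⟩ : q.primeCompl))
  obtain ⟨⟨c, c'⟩, hb⟩ := IsLocalization.surj q.primeCompl b
  obtain ⟨m, hm⟩ := exists_isIntegral_pow_mul_of_isIntegral hrint hrm (hC c)
  obtain ⟨m', hm'⟩ := exists_isIntegral_pow_mul_of_isIntegral hrint hrm (hC c')
  have hlint {z : Cs} (hz : IsIntegral R z) : IsIntegral R (l z) := hz.map (l.restrictScalars R)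
  have hrint' : IsIntegral R (r : Cs) := hrint.algebraMap (B := Cs)
  -- Numerator and denominator need different powers of `r`, so both are multiplied by the product
  -- of the two.
  refine ⟨l (r ^ m' * (r ^ m * algebraMap C Cs c)), l (r ^ m * (r ^ m' * algebraMap C Cs c')),
    hlint ((hrint'.pow _).mul hm), hlint ((hrint'.pow _).mul hm'), ?_, ?_⟩
  · simp only [map_mul, map_pow, hl]
    exact (hru.pow _).mul ((hru.pow _).mul (IsLocalization.map_units B c'))
  · simp only [map_mul, map_pow, hl, ← hb]
    ring

end ZariskiMain

/-! ### Spreading an étale generator out to an affine neighborhood -/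

section SpreadingOut

theorem IsEtaleGenerator.mul_unit {A B : Type*} [CommRing A] [IsDomain A] [IsIntegrallyClosed A]
    [CommRing B] [IsDomain B] [IsLocalRing B] [Algebra A B] [FaithfulSMul A B] {t : B}
    (ht : IsEtaleGenerator A t) (a : Aˣ) : IsEtaleGenerator A (algebraMap A B a * t) := by
  have hint : IsIntegral A (algebraMap A B a * t) := isIntegral_algebraMap.mul ht.isIntegral
  have hev (u : A[X]) :
      aeval (algebraMap A B a * t) (u.comp (C ((a⁻¹ : Aˣ) : A) * X)) = aeval t u := by
    rw [aeval_comp, map_mul, aeval_C, aeval_X, ← mul_assoc, ← map_mul, Units.inv_mul, map_one,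
      one_mul]
  refine ⟨hint, Ideal.mul_mem_left _ _ ht.mem_maximalIdeal, ?_, ?_⟩
  · refine isUnit_aeval_derivative_minpoly hint
      (F := (minpoly A t).comp (C ((a⁻¹ : Aˣ) : A) * X)) ?_ ?_
    · rw [hev, minpoly.aeval]
    · rw [derivative_comp, map_mul, hev]
      refine IsUnit.mul ?_ ht.isUnit
      simp only [derivative_mul, derivative_C, zero_mul, derivative_X, mul_one, zero_add, aeval_C]
      exact (Units.isUnit _).map _
  · rw [eq_top_iff]
    rintro b -
    obtain ⟨u, v, hv, hb⟩ : b ∈ fractionsAdjoin A t := ht.eq_top ▸ trivial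
    exact ⟨u.comp (C ((a⁻¹ : Aˣ) : A) * X), v.comp (C ((a⁻¹ : Aˣ) : A) * X), by rwa [hev],
      by rwa [hev, hev]⟩

/-- A common denominator of the coefficients of the minimal polynomial is a unit of `A`. Multiplying
`t` by it preserves the generator and scales the roots, which clears the denominators. -/
theorem exists_monic_map_eq_minpoly {R A B : Type*} [CommRing R] [CommRing A] [IsDomain A]
    [IsIntegrallyClosed A] [CommRing B] [IsDomain B] [IsLocalRing B] [Algebra R A] [Algebra A B]
    [FaithfulSMul A B] (p : Ideal R) [p.IsPrime] [IsLocalization.AtPrime A p] {t : B}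
    (ht : IsEtaleGenerator A t) :
    ∃ t' : B, IsEtaleGenerator A t' ∧ ∃ P : R[X], P.Monic ∧
      P.map (algebraMap R A) = minpoly A t' := by
  obtain ⟨s, hs, hN⟩ := IsLocalization.integerNormalization_spec p.primeCompl (minpoly A t)
  obtain ⟨a, ha⟩ := IsLocalization.map_units A (⟨s, hs⟩ : p.primeCompl)
  have ha' : (a : A) = algebraMap R A s := ha
  have hmp : minpoly A (algebraMap A B a * t) = (minpoly A t).scaleRoots a := by
    rw [← Algebra.smul_def]
    exact IsIntegrallyClosed.minpoly_smul a.ne_zero ht.isIntegral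
  have hmon := (monic_scaleRoots_iff (a : A)).2 (minpoly.monic ht.isIntegral)
  have hlift : (minpoly A t).scaleRoots (a : A) ∈ lifts (algebraMap R A) := by
    rw [lifts_iff_coeff_lifts]
    intro i
    rw [coeff_scaleRoots]
    rcases lt_trichotomy i (minpoly A t).natDegree with h | h | h
    · obtain ⟨k, hk⟩ := Nat.exists_eq_add_of_lt h
      have : (minpoly A t).natDegree - i = k + 1 := by lia
      rw [this, pow_succ', ← mul_assoc, mul_comm _ (a : A), ha', ← Algebra.smul_def,
        ← coeff_smul, ← hN, coeff_map, ← map_pow, ← map_mul]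
      exact ⟨_, rfl⟩
    · rw [h, Nat.sub_self, pow_zero, mul_one, (minpoly.monic ht.isIntegral).coeff_natDegree]
      exact ⟨1, map_one _⟩
    · rw [coeff_eq_zero_of_natDegree_lt h, zero_mul]
      exact ⟨0, map_zero _⟩
  obtain ⟨P, hP, -, hPm⟩ := lifts_and_natDegree_eq_and_monic hlift hmon
  exact ⟨_, ht.mul_unit a, P, hPm, hP.trans hmp.symm⟩

theorem isLocalization_away_of_exists_pow_mul {C E : Type*} [CommRing C] [CommRing E] [Algebra C E]
    (hinj : Function.Injective (algebraMap C E)) (c : C)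
    (h : ∀ e : E, ∃ (n : ℕ) (x : C), algebraMap C E c ^ n * e = algebraMap C E x) :
    IsLocalization.Away c (Localization.Away (algebraMap C E c)) := by
  have htower (x : C) : algebraMap C (Localization.Away (algebraMap C E c)) x =
      algebraMap E _ (algebraMap C E x) := IsScalarTower.algebraMap_apply _ _ _ _
  refine ⟨⟨?_, ?_, ?_⟩⟩
  · rintro ⟨_, n, rfl⟩
    simp only [map_pow, htower]
    exact (IsLocalization.Away.algebraMap_isUnit _).pow n
  · intro z
    obtain ⟨⟨e, ⟨_, n, rfl⟩⟩, hz⟩ := IsLocalization.surj (.powers (algebraMap C E c)) z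
    obtain ⟨m, x, hx⟩ := h e
    refine ⟨⟨x, ⟨_, n + m, rfl⟩⟩, ?_⟩
    simp only [htower, map_pow] at hz ⊢
    rw [← hx, map_mul, ← hz, map_pow]
    ring
  · intro x y hxy
    rw [htower, htower] at hxy
    obtain ⟨⟨_, n, rfl⟩, hn⟩ := IsLocalization.exists_of_eq
      (M := .powers (algebraMap C E c)) hxy
    refine ⟨⟨_, n, rfl⟩, hinj ?_⟩
    simpa using hn

section

variable {R A B : Type*} [CommRing R] [CommRing A] [CommRing B] [Algebra R A] [Algebra A B]
  [Algebra R B] [IsScalarTower R A B] [IsLocalRing B]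

theorem IsEtaleGenerator.exists_polynomial (p : Ideal R) [p.IsPrime] [IsLocalization.AtPrime A p]
    {t : B} (ht : IsEtaleGenerator A t) (b : B) :
    ∃ u v : R[X], IsUnit (aeval t v) ∧ b * aeval t v = aeval t u := by
  obtain ⟨u, v, hv, hb⟩ : b ∈ fractionsAdjoin A t := ht.eq_top ▸ trivial
  have key (w : A[X]) : ∃ s : p.primeCompl, ∃ w' : R[X],
      aeval t w' = algebraMap R B s * aeval t w := by
    obtain ⟨s, hs, hN⟩ := IsLocalization.integerNormalization_spec p.primeCompl w
    refine ⟨⟨s, hs⟩, IsLocalization.integerNormalization p.primeCompl w, ?_⟩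
    rw [← aeval_map_algebraMap A, hN, ← algebraMap_smul A s w, map_smul, Algebra.smul_def,
      ← IsScalarTower.algebraMap_apply]
  have hunit (s : p.primeCompl) : IsUnit (algebraMap R B s) := by
    rw [IsScalarTower.algebraMap_apply R A B]
    exact (IsLocalization.map_units A s).map _
  obtain ⟨s, u', hu'⟩ := key u
  obtain ⟨r, v', hv'⟩ := key v
  refine ⟨C (r : R) * u', C (s : R) * v', ?_, ?_⟩
  · rw [map_mul, aeval_C, hv']
    exact (hunit s).mul ((hunit r).mul hv)
  · simp only [map_mul, aeval_C, hv', hu', ← hb]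
    ring

theorem IsEtaleGenerator.exists_common_denominator (p : Ideal R) [p.IsPrime]
    [IsLocalization.AtPrime A p] {t : B} (ht : IsEtaleGenerator A t) (T : Finset B) :
    ∃ G : R[X], IsUnit (aeval t G) ∧ ∀ b ∈ T, ∃ u : R[X], b * aeval t G = aeval t u := by
  classical
  induction T using Finset.induction_on with
  | empty => exact ⟨1, by simp, by simp⟩
  | insert b T _ ih =>
    obtain ⟨G, hG, hT⟩ := ih
    obtain ⟨u, v, hv, hb⟩ := ht.exists_polynomial p b
    refine ⟨G * v, by simpa using ⟨hG, hv⟩, fun x hx => ?_⟩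
    rcases Finset.mem_insert.1 hx with rfl | hx
    · exact ⟨u * G, by simp only [map_mul, ← hb]; ring⟩
    · obtain ⟨w, hw⟩ := hT x hx
      exact ⟨w * v, by simp only [map_mul, ← hw]; ring⟩

end

/-- A standard étale algebra over an integrally closed domain, inside the field `L`, contains every
element of `L` integral over it. -/
theorem exists_lift_eq_of_isIntegral {R : Type*} (K : Type*) {L : Type*} [CommRing R] [IsDomain R]
    [IsIntegrallyClosed R] [Field K] [Field L] [Algebra R K] [IsFractionRing R K] [Algebra K L]
    [Algebra R L] [IsScalarTower R K L] {P : StandardEtalePair R} {t : L} (ht : P.HasMap t)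
    (htop : Algebra.adjoin K {t} = ⊤) (hP : P.f.map (algebraMap R K) = minpoly K t) {z : L}
    (hz : (P.lift t ht).toRingHom.IsIntegralElem z) : ∃ e : P.Ring, P.lift t ht e = z := by
  let := (P.lift t ht).toRingHom.toAlgebra
  have : IsScalarTower R P.Ring L := .of_algebraMap_eq' (P.lift t ht).comp_algebraMap.symm
  have hX : IsIntegral R P.X := ⟨P.f, P.monic_f, P.hasMap_X.1⟩
  have hXint (u : R[X]) : IsIntegral R (aeval P.X u) :=
    (_root_.adjoin_le_integralClosure hX : Algebra.adjoin R {P.X} ≤ integralClosure R P.Ring)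
      (aeval_mem_adjoin_singleton R P.X)
  -- A power of `g(t)` makes `z` integral over `R`, and the derivative then moves it into `R[t]`.
  -- Both factors come from units of `P.Ring`, so they can be divided out.
  obtain ⟨m, hm⟩ := exists_isIntegral_pow_mul_of_isIntegral (R := R) (C₁ := P.Ring)
    (hXint P.g) (fun x => by
      obtain ⟨p, n, hp⟩ := P.exists_mul_pow_eq x
      exact ⟨n, by rw [mul_comm, hp]; exact hXint p⟩) (c := z) hz
  have hder : aeval t (derivative (minpoly K t)) = aeval t (derivative P.f) := by
    rw [← hP, derivative_map, aeval_map_algebraMap]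
  have htint : IsIntegral R t := ⟨P.f, P.monic_f, ht.1⟩
  have hmem := aeval_derivative_minpoly_mul_mem_adjoin K htint htop
    (by rw [hder]; exact ht.isUnit_derivative_f.ne_zero) hm
  rw [Algebra.adjoin_singleton_eq_range_aeval, hder] at hmem
  obtain ⟨w, hw⟩ := hmem
  obtain ⟨d, hd⟩ := (P.hasMap_X.isUnit_derivative_f.mul (P.hasMap_X.2.pow m)).exists_left_inv
  refine ⟨d * aeval P.X w, ?_⟩
  have hw' : aeval t w = aeval t (derivative P.f) * ((P.lift t ht (aeval P.X P.g)) ^ m * z) := hw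
  rw [map_mul, StandardEtalePair.lift_aeval ht, hw', ← StandardEtalePair.lift_aeval ht, ← mul_assoc,
    ← mul_assoc, mul_assoc (P.lift t ht d), ← map_pow, ← map_mul, ← map_mul, hd, map_one, one_mul]

/-- If the local ring of `C` at `q` is strictly local-étale over the local ring of `R`, then `C` is
étale over `R` near `q`, provided that `C` is of finite type over `R`, or that `R` is integrally
closed and `C` is integral over an algebra of finite type. -/
theorem exists_etale_away {R C A B K L : Type u} [CommRing R] [IsDomain R] [CommRing C]
    [CommRing A] [CommRing B] [Field K] [Field L]
    [IsDomain A] [IsIntegrallyClosed A] [IsDomain B] [IsLocalRing B]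
    [Algebra R C] [Algebra R A] [Algebra R B] [Algebra C B] [Algebra A B]
    [IsScalarTower R A B] [IsScalarTower R C B] [FaithfulSMul A B]
    [Algebra R K] [Algebra A K] [IsFractionRing R K] [IsFractionRing A K] [IsScalarTower R A K]
    [Algebra K L] [Algebra B L] [IsFractionRing B L] [Algebra A L] [Algebra R L]
    [IsScalarTower A K L] [IsScalarTower A B L] [IsScalarTower R K L] [IsScalarTower R B L]
    (hCB : Function.Injective (algebraMap C B))
    (p : Ideal R) [p.IsPrime] [IsLocalization.AtPrime A p]
    (q : Ideal C) [q.IsPrime] [IsLocalization.AtPrime B q] {t : B} (ht : IsEtaleGenerator A t)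
    (T : Finset C)
    (hT : Algebra.adjoin R (T : Set C) = ⊤ ∨
      IsIntegrallyClosed R ∧ ∀ c : C, IsIntegral (Algebra.adjoin R (T : Set C)) c) :
    ∃ c ∉ q, ((algebraMap C (Localization.Away c)).comp (algebraMap R C)).Etale := by
  classical
  obtain ⟨t, ht, P, hPm, hP⟩ := exists_monic_map_eq_minpoly p ht
  obtain ⟨G, hG, hGT⟩ := ht.exists_common_denominator p (T.image (algebraMap C B))
  -- Inverting `P'` gives étaleness, and inverting `G` makes room for the elements of `T`. The pair
  -- condition reads `P' G + P * 0 = (P' G) ^ 1`.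
  let Q : StandardEtalePair R := ⟨P, hPm, derivative P * G, G, 0, 1, by simp⟩
  have hRA : Function.Injective (algebraMap R A) := by
    refine .of_comp (f := algebraMap A K) ?_
    rw [← RingHom.coe_comp, ← IsScalarTower.algebraMap_eq]
    exact IsFractionRing.injective R K
  have hP0 : aeval t P = 0 := by
    rw [← aeval_map_algebraMap A, hP, minpoly.aeval]
  have hP' : IsUnit (aeval t (derivative P)) := by
    rw [← aeval_map_algebraMap A, ← derivative_map, hP]
    exact ht.isUnit
  have hQ : Q.HasMap t := ⟨hP0, by simpa [Q] using ⟨hP', hG⟩⟩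
  let j := Q.lift t hQ
  have hj : Function.Injective j := by
    refine StandardEtalePair.lift_injective hQ fun w hw => ?_
    rw [← aeval_map_algebraMap A] at hw
    have := minpoly.isIntegrallyClosed_dvd ht.isIntegral hw
    rw [← hP] at this
    exact (map_dvd_map _ hRA hPm).1 this
  have hTj (c : C) (hc : c ∈ T) : algebraMap C B c ∈ j.range := by
    obtain ⟨u, hu⟩ := hGT _ (Finset.mem_image_of_mem _ hc)
    have hGu : IsUnit (aeval Q.X G) := by
      have := Q.hasMap_X.2
      simp only [Q, map_mul] at this
      exact isUnit_of_mul_isUnit_right this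
    obtain ⟨d, hd⟩ := hGu.exists_right_inv
    refine ⟨aeval Q.X u * d, ?_⟩
    have h1 : j (aeval Q.X u) = aeval t u := StandardEtalePair.lift_aeval hQ u
    have h2 : j (aeval Q.X G) = aeval t G := StandardEtalePair.lift_aeval hQ G
    change j _ = _
    rw [map_mul, h1, ← hu, ← h2, mul_assoc, ← map_mul, hd, map_one, mul_one]
  have hadj : Algebra.adjoin R (T : Set C) ≤ j.range.comap (IsScalarTower.toAlgHom R C B) :=
    Algebra.adjoin_le fun c hc => hTj c hc
  have hCj (c : C) : algebraMap C B c ∈ j.range := by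
    rcases hT with hT | ⟨hR, hT⟩
    · exact hadj (hT ▸ Algebra.mem_top : c ∈ Algebra.adjoin R (T : Set C))
    · have hBL := IsFractionRing.injective B L
      have hQL : Q.HasMap (algebraMap B L t) := hQ.map (IsScalarTower.toAlgHom R B L)
      have hjL (e : Q.Ring) : Q.lift _ hQL e = algebraMap B L (j e) := by
        have : Q.lift _ hQL = (IsScalarTower.toAlgHom R B L).comp j := by
          ext
          simp [j]
        rw [this]
        rfl
      have hPK : Q.f.map (algebraMap R K) = minpoly K (algebraMap B L t) := by
        rw [minpoly_algebraMap_eq_map K L ht.isIntegral, ← hP, Polynomial.map_map,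
          ← IsScalarTower.algebraMap_eq]
      obtain ⟨e, he⟩ := exists_lift_eq_of_isIntegral K hQL (ht.adjoin_eq_top K L) hPK
        (z := algebraMap B L (algebraMap C B c)) (by
          obtain ⟨F, hF, hF0⟩ := hT c
          let i : Algebra.adjoin R (T : Set C) →+* Q.Ring :=
            ((AlgEquiv.ofInjective j hj).symm : j.range →+* Q.Ring).comp
              (((algebraMap C B).comp (algebraMap (Algebra.adjoin R (T : Set C)) C)).codRestrict
                j.range.toSubring fun x => hadj x.2)
          have hi (x) : j (i x) = algebraMap C B x :=
            congrArg Subtype.val ((AlgEquiv.ofInjective j hj).apply_symm_apply _)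
          refine ⟨F.map i, hF.map _, ?_⟩
          rw [eval₂_map]
          have h1 : (Q.lift _ hQL).toRingHom.comp i = ((algebraMap B L).comp (algebraMap C B)).comp
              (algebraMap (Algebra.adjoin R (T : Set C)) C) := by
            ext x
            exact (hjL _).trans (congrArg _ (hi x))
          rw [h1]
          have h2 := hom_eval₂ F (algebraMap (Algebra.adjoin R (T : Set C)) C)
            ((algebraMap B L).comp (algebraMap C B)) c
          rw [hF0, map_zero] at h2
          exact h2.symm)
      exact ⟨e, hBL ((hjL e).symm.trans he)⟩
  let ι : C →+* Q.Ring := ((AlgEquiv.ofInjective j hj).symm : j.range →+* Q.Ring).comp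
    ((algebraMap C B).codRestrict j.range.toSubring hCj)
  have hι (c : C) : j (ι c) = algebraMap C B c :=
    congrArg Subtype.val ((AlgEquiv.ofInjective j hj).apply_symm_apply _)
  let := ι.toAlgebra
  have hιinj : Function.Injective (algebraMap C Q.Ring) := fun x y hxy => hCB (by
    rw [← hι, ← hι]
    exact congrArg j hxy)
  have : IsScalarTower R C Q.Ring := .of_algebraMap_eq fun r => hj (by
    refine (j.commutes r).trans ?_
    exact (IsScalarTower.algebraMap_apply R C B r).trans (hι _).symm)
  obtain ⟨S, hS⟩ := (inferInstance : Algebra.FiniteType R Q.Ring).out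
  -- Conversely, `B` is a localization of `C`, so one `c` outside `q` clears the denominators of
  -- finitely many generators of `Q.Ring`. Hence `C` and `Q.Ring` agree after inverting `c`.
  obtain ⟨c, hc⟩ := IsLocalization.exist_integer_multiples_of_finset q.primeCompl (S.image j)
  have hcS (e : Q.Ring) : ∃ (n : ℕ) (x : C), ι c ^ n * e = ι x := by
    have he : e ∈ Algebra.adjoin R (S : Set Q.Ring) := hS ▸ Algebra.mem_top
    induction he using Algebra.adjoin_induction with
    | mem e he =>
      obtain ⟨x, hx⟩ := hc (j e) (Finset.mem_image_of_mem _ he)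
      refine ⟨1, x, hj ?_⟩
      rw [pow_one, map_mul, hι, hι, hx, Algebra.smul_def]
    | algebraMap r =>
      refine ⟨0, algebraMap R C r, ?_⟩
      rw [pow_zero, one_mul]
      exact IsScalarTower.algebraMap_apply R C Q.Ring r
    | add x y _ _ hx hy =>
      obtain ⟨n, x', hx⟩ := hx
      obtain ⟨m, y', hy⟩ := hy
      refine ⟨n + m, c ^ m * x' + c ^ n * y', ?_⟩
      simp only [map_add, map_mul, map_pow, ← hx, ← hy]
      ring
    | mul x y _ _ hx hy =>
      obtain ⟨n, x', hx⟩ := hx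
      obtain ⟨m, y', hy⟩ := hy
      refine ⟨n + m, x' * y', ?_⟩
      simp only [map_mul, ← hx, ← hy]
      ring
  refine ⟨c, c.2, ?_⟩
  have hloc := isLocalization_away_of_exists_pow_mul hιinj (c : C) hcS
  let Ec := Localization.Away (algebraMap C Q.Ring c)
  have : Algebra.Etale Q.Ring Ec := Algebra.Etale.of_isLocalizationAway (algebraMap C Q.Ring c)
  have hetale : Algebra.Etale R Ec := .comp R Q.Ring Ec
  let e : Ec ≃ₐ[C] Localization.Away (c : C) := IsLocalization.algEquiv (.powers (c : C)) _ _
  have h1 := RingHom.Etale.respectsIso.1 (algebraMap R Ec) e.toRingEquiv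
    (RingHom.etale_algebraMap.2 hetale)
  convert h1 using 1
  ext r
  have h2 : algebraMap R Ec r = algebraMap C Ec (algebraMap R C r) := by
    rw [IsScalarTower.algebraMap_apply R Q.Ring Ec, IsScalarTower.algebraMap_apply C Q.Ring Ec,
      ← IsScalarTower.algebraMap_apply R C Q.Ring]
  refine (e.commutes (algebraMap R C r)).symm.trans ?_
  rw [← h2]
  rfl

end SpreadingOut

/-! ### The criterion for local rings -/

section LocalRings

open TensorProduct in
-- The étale `A`-algebra is the base change of `C` to `A`. It only inverts elements of `C` outside
-- `q`, so `B` is a further localization of it.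
theorem isEssentiallyEtale_of_etale {R C A B : Type u} [CommRing R] [CommRing C]
    [CommRing A] [CommRing B] [IsLocalRing B]
    [Algebra R C] [Algebra R A] [Algebra R B] [Algebra C B] [Algebra A B]
    [IsScalarTower R A B] [IsScalarTower R C B] [Algebra.Etale R C]
    (p : Ideal R) [p.IsPrime] [IsLocalization.AtPrime A p]
    (q : Ideal C) [q.IsPrime] [IsLocalization.AtPrime B q]
    (hqp : p = q.comap (algebraMap R C)) : IsEssentiallyEtale (algebraMap A B) := by
  let E := A ⊗[R] C
  let j : E →ₐ[A] B := Algebra.TensorProduct.lift (Algebra.ofId A B) (IsScalarTower.toAlgHom R C B)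
    fun _ _ => Commute.all _ _
  have hj (c : C) : j (1 ⊗ₜ c) = algebraMap C B c :=
    (Algebra.TensorProduct.lift_tmul ..).trans (by simp)
  let : Algebra C E := Algebra.TensorProduct.includeRight.toRingHom.toAlgebra
  have hCE (c : C) : algebraMap C E c = 1 ⊗ₜ c := rfl
  have : IsScalarTower R C E := .of_algebraMap_eq fun r =>
    (Algebra.TensorProduct.includeRight (R := R) (A := A) (B := C)).commutes r |>.symm
  let : Algebra E B := j.toRingHom.toAlgebra
  have : IsScalarTower C E B := .of_algebraMap_eq fun c => (hj c).symm
  have hpush : Algebra.IsPushout R C A E := inferInstance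
  have : IsLocalization (Algebra.algebraMapSubmonoid C p.primeCompl) E :=
    (Algebra.isLocalization_iff_isPushout p.primeCompl A).2 hpush
  have hle : Algebra.algebraMapSubmonoid C p.primeCompl ≤ q.primeCompl := by
    rintro _ ⟨r, hr, rfl⟩ hq
    exact hr (by rw [hqp]; exact hq)
  have : IsLocalization (q.primeCompl.map (algebraMap C E)) B :=
    IsLocalization.isLocalization_of_submonoid_le E B
      (Algebra.algebraMapSubmonoid C p.primeCompl) q.primeCompl hle
  refine ⟨E, inferInstance, algebraMap A E, j.toRingHom, (maximalIdeal B).comap j.toRingHom,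
    inferInstance, RingHom.etale_algebraMap.2 inferInstance, j.comp_algebraMap, ?_⟩
  refine IsLocalization.isLocalization_of_is_exists_mul_mem B (q.primeCompl.map (algebraMap C E))
    _ ?_ ?_
  · rintro _ ⟨c, hc, rfl⟩ hm
    have h1 : j (algebraMap C E c) ∈ maximalIdeal B := hm
    rw [hCE, hj] at h1
    exact h1 (IsLocalization.map_units B (⟨c, hc⟩ : q.primeCompl))
  · rintro ⟨e, he⟩
    obtain ⟨⟨c, m⟩, hc⟩ :=
      IsLocalization.surj (Algebra.algebraMapSubmonoid C p.primeCompl) e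
    refine ⟨algebraMap C E m, c, ?_, ?_⟩
    · intro hcq
      have hu : IsUnit (j e) := not_not.1 he
      have hm : IsUnit (j (algebraMap C E m)) := by
        rw [hCE, hj]
        exact IsLocalization.map_units B (⟨m, hle m.2⟩ : q.primeCompl)
      have h2 := congrArg j hc
      rw [map_mul, hCE c, hj] at h2
      exact (IsLocalization.AtPrime.isUnit_to_map_iff B q c).1 (h2 ▸ hu.mul hm) hcq
    · rw [mul_comm]
      exact hc.symm

theorem faithfulSMul_of_isFractionRing (A B K L : Type*) [CommRing A] [CommRing B] [Field K]
    [Field L] [Algebra A B] [Algebra A K] [IsFractionRing A K] [Algebra B L] [Algebra K L]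
    [Algebra A L] [IsScalarTower A K L] [IsScalarTower A B L] : FaithfulSMul A B := by
  rw [faithfulSMul_iff_algebraMap_injective]
  refine .of_comp (f := algebraMap B L) ?_
  rw [← RingHom.coe_comp, ← IsScalarTower.algebraMap_eq, IsScalarTower.algebraMap_eq A K L]
  exact (algebraMap K L).injective.comp (IsFractionRing.injective A K)

variable {A B K L : Type u} [CommRing A] [CommRing B] [IsLocalRing A] [IsLocalRing B]
  [IsDomain A] [IsIntegrallyClosed A] [IsDomain B] [Field K] [Field L] [Algebra A B]
  [Algebra A K] [IsFractionRing A K] [Algebra B L] [IsFractionRing B L] [Algebra K L]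
  [Algebra A L] [IsScalarTower A K L] [IsScalarTower A B L] [IsLocalHom (algebraMap A B)]

/-- The valuative criterion for local rings. -/
theorem isStrictlyLocalEtale_iff_exists_valuationSubring
    (hB : ∀ b : B, ∃ d e : B, IsIntegral A d ∧ IsIntegral A e ∧ IsUnit e ∧ b * e = d) :
    IsStrictlyLocalEtale (algebraMap A B) ↔
      ∃ O : ValuationSubring K, Dominates A O ∧ ∃ O' : ValuationSubring L,
        ∃ h : Extends (algebraMap K L) O O', Dominates B O' ∧
          (∀ O'' : ValuationSubring L, Extends (algebraMap K L) O O'' → Dominates B O'' →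
            O'' = O') ∧ IsStrictlyLocalEtale h.ringHom := by
  have := faithfulSMul_of_isFractionRing A B K L
  constructor
  · intro h
    obtain ⟨t, ht⟩ := h.exists_isEtaleGenerator
    exact ht.exists_valuationSubring K L
  · rintro ⟨O, hO, O', h, hO', huniq, het⟩
    obtain ⟨t, ht⟩ := exists_isEtaleGenerator_of_extends hB hO h hO' huniq het
    exact ht.isStrictlyLocalEtale

end LocalRings

/-! ### Translation to schemes -/

section Schemes

variable {X Y : Scheme.{u}}

theorem hasRingHomProperty_resLE_iff {P : MorphismProperty Scheme.{u}}
    {Q : ∀ {R S : Type u} [CommRing R] [CommRing S], (R →+* S) → Prop} [HasRingHomProperty P Q]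
    (f : Y ⟶ X) {U : X.Opens} {V : Y.Opens} (hU : IsAffineOpen U) (hV : IsAffineOpen V)
    (e : V ≤ f ⁻¹ᵁ U) : P (f.resLE U V e) ↔ Q (f.appLE U V e).hom := by
  have : IsAffine U := hU
  have : IsAffine V := hV
  have := RingHom.toMorphismProperty_respectsIso_iff.1
    (HasRingHomProperty.isLocal_ringHomProperty P).respectsIso
  rw [HasRingHomProperty.iff_of_isAffine (P := P)]
  exact MorphismProperty.arrow_mk_iso_iff (RingHom.toMorphismProperty Q) (arrowResLEAppIso f U V e)

theorem etale_ι_comp_iff (f : Y ⟶ X) {U : X.Opens} {V : Y.Opens} (hU : IsAffineOpen U)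
    (hV : IsAffineOpen V) (e : V ≤ f ⁻¹ᵁ U) :
    Etale (V.ι ≫ f) ↔ (f.appLE U V e).hom.Etale := by
  rw [← hasRingHomProperty_resLE_iff (P := @Etale) f hU hV e, ← Scheme.Hom.resLE_comp_ι f e]
  exact ⟨fun _ => Etale.of_comp _ U.ι, fun _ => inferInstance⟩

theorem finiteType_appLE (f : Y ⟶ X) {U : X.Opens} {V : Y.Opens} (hU : IsAffineOpen U)
    (hV : IsAffineOpen V) (e : V ≤ f ⁻¹ᵁ U) [h : LocallyOfFiniteType (V.ι ≫ f)] :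
    (f.appLE U V e).hom.FiniteType := by
  rw [← hasRingHomProperty_resLE_iff (P := @LocallyOfFiniteType) f hU hV e]
  rw [← Scheme.Hom.resLE_comp_ι f e] at h
  exact locallyOfFiniteType_of_comp _ U.ι

theorem homOfLE_comp_ι_comp (f : Y ⟶ X) {V W : Y.Opens} (h : V ≤ W) :
    Y.homOfLE h ≫ W.ι ≫ f = V.ι ≫ f := by
  rw [Scheme.homOfLE_ι_assoc]

theorem germ_comp_stalkMap (f : Y ⟶ X) {U : X.Opens} {V : Y.Opens} (e : V ≤ f ⁻¹ᵁ U) (y : Y)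
    (hy : y ∈ V) (hx : f y ∈ U) :
    X.presheaf.germ U (f y) hx ≫ f.stalkMap y = f.appLE U V e ≫ Y.presheaf.germ V y hy := by
  rw [Scheme.Hom.germ_stalkMap, Scheme.Hom.appLE, Category.assoc, Y.presheaf.germ_res]

/-- A partial normalization embeds into an integral closure, so its sections are integral over those
of `Y₀`. The set `T` is the image of finitely many generators of the latter. The open `W` allows `U`
to be chosen inside the normal locus. -/
theorem IsNormalizedFiniteType.exists_isIntegral_adjoin {f : Y ⟶ X}
    (hf : IsNormalizedFiniteType f) {y : Y} {W : X.Opens} (hW : f y ∈ W) :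
    ∃ (U : X.Opens) (V : Y.Opens) (e : V ≤ f ⁻¹ᵁ U), IsAffineOpen U ∧ IsAffineOpen V ∧ U ≤ W ∧
      y ∈ V ∧
      letI := (f.appLE U V e).hom.toAlgebra
      ∃ T : Finset Γ(Y, V), ∀ c : Γ(Y, V),
        IsIntegral (Algebra.adjoin Γ(X, U) (T : Set Γ(Y, V))) c := by
  classical
  obtain ⟨Y₀, g, h, hg, hh, -, rfl⟩ := hf
  obtain ⟨U, hU, hyU, hUW⟩ := exists_isAffineOpen_mem_and_subset hW
  obtain ⟨V₀, hV₀, hyV₀, hV₀U⟩ := exists_isAffineOpen_mem_and_subset (x := g y)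
    (U := h ⁻¹ᵁ U) (by simpa using hyU)
  replace hV₀U : V₀ ≤ h ⁻¹ᵁ U := hV₀U
  have := hg.isAffineHom
  have e : g ⁻¹ᵁ V₀ ≤ (g ≫ h) ⁻¹ᵁ U := fun z hz => hV₀U hz
  refine ⟨U, g ⁻¹ᵁ V₀, e, hU, hV₀.preimage g, hUW, hyV₀, ?_⟩
  obtain ⟨φ, hφ, hφg⟩ := hg.exists_embedding V₀ hV₀
  have hint : (g.app V₀).hom.IsIntegral := by
    intro c
    obtain ⟨p, hp, hpc⟩ :=
      Algebra.IsIntegral.isIntegral (R := Γ(Y₀, V₀)) (φ c)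
    refine ⟨p, hp, hφ ?_⟩
    rw [Polynomial.hom_eval₂, hφg, map_zero]
    exact hpc
  have hft : (h.appLE U V₀ hV₀U).hom.FiniteType :=
    HasRingHomProperty.appLE @LocallyOfFiniteType h hh ⟨U, hU⟩ ⟨V₀, hV₀⟩ hV₀U
  have hcomp : ((g ≫ h).appLE U (g ⁻¹ᵁ V₀) e).hom =
      (g.app V₀).hom.comp (h.appLE U V₀ hV₀U).hom := by
    rw [← CommRingCat.hom_comp, Scheme.Hom.app_eq_appLE, Scheme.Hom.appLE_comp_appLE]
  let : Algebra Γ(X, U) Γ(Y₀, V₀) := (h.appLE U V₀ hV₀U).hom.toAlgebra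
  let : Algebra Γ(Y₀, V₀) Γ(Y, g ⁻¹ᵁ V₀) := (g.app V₀).hom.toAlgebra
  let : Algebra Γ(X, U) Γ(Y, g ⁻¹ᵁ V₀) := ((g ≫ h).appLE U (g ⁻¹ᵁ V₀) e).hom.toAlgebra
  have : IsScalarTower Γ(X, U) Γ(Y₀, V₀) Γ(Y, g ⁻¹ᵁ V₀) := .of_algebraMap_eq' hcomp
  obtain ⟨S, hS⟩ := (show Algebra.FiniteType Γ(X, U) Γ(Y₀, V₀) from hft).out
  let T := S.image (algebraMap Γ(Y₀, V₀) Γ(Y, g ⁻¹ᵁ V₀))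
  have hmem (a : Γ(Y₀, V₀)) : algebraMap Γ(Y₀, V₀) Γ(Y, g ⁻¹ᵁ V₀) a ∈
      Algebra.adjoin Γ(X, U) (T : Set Γ(Y, g ⁻¹ᵁ V₀)) := by
    have h1 : IsScalarTower.toAlgHom Γ(X, U) Γ(Y₀, V₀) Γ(Y, g ⁻¹ᵁ V₀) a ∈
        (Algebra.adjoin Γ(X, U) (S : Set Γ(Y₀, V₀))).map (IsScalarTower.toAlgHom _ _ _) :=
      ⟨a, by rw [hS]; trivial, rfl⟩
    rw [AlgHom.map_adjoin] at h1
    simpa [T] using h1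
  refine ⟨T, fun c => ?_⟩
  obtain ⟨p, hp, hpc⟩ := hint c
  let ψ : Γ(Y₀, V₀) →+* Algebra.adjoin Γ(X, U) (T : Set Γ(Y, g ⁻¹ᵁ V₀)) :=
    (algebraMap Γ(Y₀, V₀) Γ(Y, g ⁻¹ᵁ V₀)).codRestrict _ hmem
  refine ⟨p.map ψ, hp.map ψ, ?_⟩
  rw [eval₂_map]
  exact hpc

theorem mem_basicOpen_iff_notMem_primeIdealOf {V : Y.Opens} (hV : IsAffineOpen V) {y : Y}
    (hy : y ∈ V) (s : Γ(Y, V)) :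
    y ∈ Y.basicOpen s ↔ s ∉ (hV.primeIdealOf ⟨y, hy⟩).asIdeal := by
  have h : hV.primeIdealOf ⟨y, hy⟩ ∈ hV.fromSpec ⁻¹ᵁ Y.basicOpen s ↔ y ∈ Y.basicOpen s := by
    change hV.fromSpec (hV.primeIdealOf ⟨y, hy⟩) ∈ Y.basicOpen s ↔ _
    rw [hV.fromSpec_primeIdealOf]
  rw [← h, hV.fromSpec_preimage_basicOpen]
  exact PrimeSpectrum.mem_basicOpen ..

theorem exists_primeIdealOf_eq {V : Y.Opens} (hV : IsAffineOpen V) (q : PrimeSpectrum Γ(Y, V)) :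
    ∃ (y : Y) (hy : y ∈ V), hV.primeIdealOf ⟨y, hy⟩ = q := by
  have hy : hV.fromSpec q ∈ V := by
    have h : hV.fromSpec q ∈ (hV.fromSpec.opensRange : Set Y) := ⟨q, rfl⟩
    rwa [hV.opensRange_fromSpec] at h
  exact ⟨hV.fromSpec q, hy, hV.fromSpec.isOpenEmbedding.injective (hV.fromSpec_primeIdealOf _)⟩

/-- A basic open neighborhood of `y` inside the isolating open set supplies `s`; primes avoiding `s`
are its points. -/
theorem IsIsolatedInFiber.exists_notMem_primeIdealOf {f : Y ⟶ X} {y : Y}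
    (h : IsIsolatedInFiber f y) {U : X.Opens} {V : Y.Opens} (hU : IsAffineOpen U)
    (hV : IsAffineOpen V) (e : V ≤ f ⁻¹ᵁ U) (hy : y ∈ V) :
    ∃ s ∉ (hV.primeIdealOf ⟨y, hy⟩).asIdeal, ∀ q : Ideal Γ(Y, V), q.IsPrime → s ∉ q →
      q.comap (f.appLE U V e).hom =
        (hV.primeIdealOf ⟨y, hy⟩).asIdeal.comap (f.appLE U V e).hom →
      q = (hV.primeIdealOf ⟨y, hy⟩).asIdeal := by
  obtain ⟨W, hW⟩ := h
  have hyW : y ∈ W := (hW.symm ▸ Set.mem_singleton y : y ∈ (W : Set Y) ∩ f ⁻¹' {f y}).1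
  obtain ⟨s, hsW, hys⟩ := hV.exists_basicOpen_le ⟨y, hyW⟩ hy
  refine ⟨s, (mem_basicOpen_iff_notMem_primeIdealOf hV hy s).1 hys, fun q hq hsq hqy => ?_⟩
  obtain ⟨z, hz, hzq⟩ := exists_primeIdealOf_eq hV ⟨q, hq⟩
  have hzs : z ∈ Y.basicOpen s :=
    (mem_basicOpen_iff_notMem_primeIdealOf hV hz s).2 (by rw [hzq]; exact hsq)
  have hp : hU.primeIdealOf ⟨f z, e hz⟩ = hU.primeIdealOf ⟨f y, e hy⟩ := by
    rw [← IsAffineOpen.comap_primeIdealOf_appLE U hU V hV e hz,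
      ← IsAffineOpen.comap_primeIdealOf_appLE U hU V hV e hy, hzq]
    exact PrimeSpectrum.ext hqy
  have hfz : f z = f y := by
    exact (hU.fromSpec_primeIdealOf ⟨f z, e hz⟩).symm.trans
      (hp ▸ hU.fromSpec_primeIdealOf ⟨f y, e hy⟩)
  have hzy : z ∈ ({y} : Set Y) := by
    rw [← hW]
    exact ⟨hsW hzs, hfz⟩
  obtain rfl : z = y := hzy
  rw [hzq]

theorem exists_isIntegral_stalk_mul_eq {f : Y ⟶ X} (hf : IsNormalizedFiniteType f) {y : Y}
    (hy : IsIsolatedInFiber f y) :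
    letI := (f.stalkMap y).hom.toAlgebra
    ∀ b : Y.presheaf.stalk y, ∃ d e : Y.presheaf.stalk y, IsIntegral (X.presheaf.stalk (f y)) d ∧
      IsIntegral (X.presheaf.stalk (f y)) e ∧ IsUnit e ∧ b * e = d := by
  intro b
  obtain ⟨U, V, e, hU, hV, -, hyV, T, hT⟩ :=
    hf.exists_isIntegral_adjoin (y := y) (W := ⊤) trivial
  have hx : f y ∈ U := e hyV
  let : Algebra Γ(X, U) Γ(Y, V) := (f.appLE U V e).hom.toAlgebra
  let : Algebra Γ(X, U) (X.presheaf.stalk (f y)) := X.presheaf.algebra_section_stalk ⟨f y, hx⟩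
  let : Algebra Γ(Y, V) (Y.presheaf.stalk y) := Y.presheaf.algebra_section_stalk ⟨y, hyV⟩
  let : Algebra (X.presheaf.stalk (f y)) (Y.presheaf.stalk y) := (f.stalkMap y).hom.toAlgebra
  let : Algebra Γ(X, U) (Y.presheaf.stalk y) :=
    ((algebraMap Γ(Y, V) (Y.presheaf.stalk y)).comp (algebraMap Γ(X, U) Γ(Y, V))).toAlgebra
  have : IsScalarTower Γ(X, U) Γ(Y, V) (Y.presheaf.stalk y) := .of_algebraMap_eq' rfl
  have : IsScalarTower Γ(X, U) (X.presheaf.stalk (f y)) (Y.presheaf.stalk y) :=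
    .of_algebraMap_eq' congr(($(germ_comp_stalkMap f e y hyV hx)).hom).symm
  have : IsLocalization.AtPrime (Y.presheaf.stalk y) (hV.primeIdealOf ⟨y, hyV⟩).asIdeal :=
    hV.isLocalization_stalk ⟨y, hyV⟩
  have : Algebra.FiniteType Γ(X, U) (Algebra.adjoin Γ(X, U) (T : Set Γ(Y, V))) :=
    Algebra.FiniteType.adjoin_of_finite T.finite_toSet
  have : Algebra.IsIntegral (Algebra.adjoin Γ(X, U) (T : Set Γ(Y, V))) Γ(Y, V) := ⟨hT⟩
  obtain ⟨s, hs, hsq⟩ := hy.exists_notMem_primeIdealOf hU hV e hyV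
  obtain ⟨d, e, hd, he, heu, hbe⟩ := exists_isIntegral_mul_eq_of_isolated
    (C₀ := Algebra.adjoin Γ(X, U) (T : Set Γ(Y, V))) _ hs hsq b
  exact ⟨d, e, hd.tower_top, he.tower_top, heu, hbe⟩

theorem isEssentiallyEtale_stalkMap {f : Y ⟶ X} {y : Y} (h : IsEtaleAt f y) :
    IsEssentiallyEtale (f.stalkMap y).hom := by
  obtain ⟨W, hyW, hW⟩ := h
  obtain ⟨U, hU, hx, -⟩ := exists_isAffineOpen_mem_and_subset (TopologicalSpace.Opens.mem_top (f y))
  obtain ⟨V, hV, hyV, hVW⟩ := exists_isAffineOpen_mem_and_subset (x := y) (U := W ⊓ f ⁻¹ᵁ U)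
    ⟨hyW, hx⟩
  have hVW' : V ≤ W := fun z hz => (hVW hz).1
  have e : V ≤ f ⁻¹ᵁ U := fun z hz => (hVW hz).2
  have het : (f.appLE U V e).hom.Etale := by
    rw [← etale_ι_comp_iff f hU hV e, ← homOfLE_comp_ι_comp f hVW']
    infer_instance
  let : Algebra Γ(X, U) Γ(Y, V) := (f.appLE U V e).hom.toAlgebra
  let : Algebra Γ(X, U) (X.presheaf.stalk (f y)) := X.presheaf.algebra_section_stalk ⟨f y, hx⟩
  let : Algebra Γ(Y, V) (Y.presheaf.stalk y) := Y.presheaf.algebra_section_stalk ⟨y, hyV⟩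
  let : Algebra (X.presheaf.stalk (f y)) (Y.presheaf.stalk y) := (f.stalkMap y).hom.toAlgebra
  let : Algebra Γ(X, U) (Y.presheaf.stalk y) :=
    ((algebraMap Γ(Y, V) (Y.presheaf.stalk y)).comp (algebraMap Γ(X, U) Γ(Y, V))).toAlgebra
  have : IsScalarTower Γ(X, U) Γ(Y, V) (Y.presheaf.stalk y) := .of_algebraMap_eq' rfl
  have : IsScalarTower Γ(X, U) (X.presheaf.stalk (f y)) (Y.presheaf.stalk y) :=
    .of_algebraMap_eq' congr(($(germ_comp_stalkMap f e y hyV hx)).hom).symm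
  have : IsLocalization.AtPrime (Y.presheaf.stalk y) (hV.primeIdealOf ⟨y, hyV⟩).asIdeal :=
    hV.isLocalization_stalk ⟨y, hyV⟩
  have : IsLocalization.AtPrime (X.presheaf.stalk (f y)) (hU.primeIdealOf ⟨f y, hx⟩).asIdeal :=
    hU.isLocalization_stalk ⟨f y, hx⟩
  have : Algebra.Etale Γ(X, U) Γ(Y, V) := het
  exact isEssentiallyEtale_of_etale (hU.primeIdealOf ⟨f y, hx⟩).asIdeal
    (hV.primeIdealOf ⟨y, hyV⟩).asIdeal
    congr(($(IsAffineOpen.comap_primeIdealOf_appLE U hU V hV e hyV)).asIdeal).symm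

theorem isIntegrallyClosed_of_isNormalAt [IsIntegral X] {U : X.Opens} (hU : IsAffineOpen U)
    (hU₀ : Nonempty U) (h : ∀ x ∈ U, IsNormalAt X x) : IsIntegrallyClosed Γ(X, U) := by
  refine IsIntegrallyClosed.of_localization_maximal fun p _ hp => ?_
  obtain ⟨x, hx, hxp⟩ := exists_primeIdealOf_eq hU ⟨p, hp.isPrime⟩
  let : Algebra Γ(X, U) (X.presheaf.stalk x) := X.presheaf.algebra_section_stalk ⟨x, hx⟩
  have := hU.isLocalization_stalk ⟨x, hx⟩
  rw [hxp] at this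
  have : IsLocalization.AtPrime (X.presheaf.stalk x) p := this
  have : IsIntegrallyClosed (X.presheaf.stalk x) := h x hx
  exact .of_equiv (IsLocalization.algEquiv p.primeCompl (X.presheaf.stalk x)
    (Localization.AtPrime p)).toRingEquiv

theorem etale_basicOpen_ι_comp (f : Y ⟶ X) {U : X.Opens} {V : Y.Opens} (hU : IsAffineOpen U)
    (hV : IsAffineOpen V) (e : V ≤ f ⁻¹ᵁ U) (c : Γ(Y, V))
    (h : ((algebraMap Γ(Y, V) (Localization.Away c)).comp (f.appLE U V e).hom).Etale) :
    Etale ((Y.basicOpen c).ι ≫ f) := by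
  have e' : Y.basicOpen c ≤ f ⁻¹ᵁ U := (Y.basicOpen_le c).trans e
  rw [etale_ι_comp_iff f hU (hV.basicOpen c) e']
  have := hV.isLocalization_basicOpen c
  let i : Localization.Away c ≃ₐ[Γ(Y, V)] Γ(Y, Y.basicOpen c) :=
    IsLocalization.algEquiv (.powers c) _ _
  have hi : (f.appLE U (Y.basicOpen c) e').hom = i.toRingEquiv.toRingHom.comp
      ((algebraMap Γ(Y, V) (Localization.Away c)).comp (f.appLE U V e).hom) := by
    rw [← Scheme.Hom.appLE_map f e (homOfLE (Y.basicOpen_le c)).op]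
    ext r
    exact (i.commutes (f.appLE U V e r)).symm
  rw [hi]
  exact RingHom.Etale.respectsIso.1 _ i.toRingEquiv h

variable [IsIntegral X] [IsIntegral Y] (f : Y ⟶ X) [IsDominant f]

theorem functionFieldMap_algebraMap (y : Y) (a : X.presheaf.stalk (f y)) :
    functionFieldMap f (algebraMap _ X.functionField a) =
      algebraMap (Y.presheaf.stalk y) Y.functionField (f.stalkMap y a) := by
  have h := f.stalkSpecializes_stalkMap (genericPoint Y) y
    ((genericPoint_spec Y).specializes trivial)
  change (X.presheaf.stalkSpecializes _ ≫ X.presheaf.stalkSpecializes _ ≫ f.stalkMap _) a =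
    (f.stalkMap y ≫ Y.presheaf.stalkSpecializes _) a
  rw [← h, TopCat.Presheaf.stalkSpecializes_comp_assoc]

theorem isEtaleAt_of_isStrictlyLocalEtale {y : Y} {U : X.Opens} {V : Y.Opens}
    (hU : IsAffineOpen U) (hV : IsAffineOpen V) (e : V ≤ f ⁻¹ᵁ U) (hy : y ∈ V)
    (hx : IsNormalAt X (f y)) (h : IsStrictlyLocalEtale (f.stalkMap y).hom)
    (hT : letI := (f.appLE U V e).hom.toAlgebra
      ∃ T : Finset Γ(Y, V), Algebra.adjoin Γ(X, U) (T : Set Γ(Y, V)) = ⊤ ∨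
        IsIntegrallyClosed Γ(X, U) ∧
          ∀ c : Γ(Y, V), IsIntegral (Algebra.adjoin Γ(X, U) (T : Set Γ(Y, V))) c) :
    IsEtaleAt f y := by
  have hxU : f y ∈ U := e hy
  have : Nonempty U := ⟨⟨f y, hxU⟩⟩
  let : Algebra Γ(X, U) Γ(Y, V) := (f.appLE U V e).hom.toAlgebra
  let : Algebra Γ(X, U) (X.presheaf.stalk (f y)) := X.presheaf.algebra_section_stalk ⟨f y, hxU⟩
  let : Algebra Γ(Y, V) (Y.presheaf.stalk y) := Y.presheaf.algebra_section_stalk ⟨y, hy⟩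
  let : Algebra (X.presheaf.stalk (f y)) (Y.presheaf.stalk y) := (f.stalkMap y).hom.toAlgebra
  let : Algebra Γ(X, U) (Y.presheaf.stalk y) :=
    ((algebraMap Γ(Y, V) (Y.presheaf.stalk y)).comp (algebraMap Γ(X, U) Γ(Y, V))).toAlgebra
  have : IsScalarTower Γ(X, U) Γ(Y, V) (Y.presheaf.stalk y) := .of_algebraMap_eq' rfl
  have : IsScalarTower Γ(X, U) (X.presheaf.stalk (f y)) (Y.presheaf.stalk y) :=
    .of_algebraMap_eq' congr(($(germ_comp_stalkMap f e y hy hxU)).hom).symm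
  have : IsLocalization.AtPrime (Y.presheaf.stalk y) (hV.primeIdealOf ⟨y, hy⟩).asIdeal :=
    hV.isLocalization_stalk ⟨y, hy⟩
  have : IsLocalization.AtPrime (X.presheaf.stalk (f y)) (hU.primeIdealOf ⟨f y, hxU⟩).asIdeal :=
    hU.isLocalization_stalk ⟨f y, hxU⟩
  have : IsIntegrallyClosed (X.presheaf.stalk (f y)) := hx
  let : Algebra X.functionField Y.functionField := (functionFieldMap f).toAlgebra
  let : Algebra (X.presheaf.stalk (f y)) Y.functionField :=
    ((algebraMap X.functionField Y.functionField).comp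
      (algebraMap (X.presheaf.stalk (f y)) X.functionField)).toAlgebra
  let : Algebra Γ(X, U) Y.functionField :=
    ((algebraMap X.functionField Y.functionField).comp
      (algebraMap Γ(X, U) X.functionField)).toAlgebra
  have : IsScalarTower (X.presheaf.stalk (f y)) X.functionField Y.functionField :=
    .of_algebraMap_eq' rfl
  have : IsScalarTower Γ(X, U) X.functionField Y.functionField := .of_algebraMap_eq' rfl
  have : IsScalarTower (X.presheaf.stalk (f y)) (Y.presheaf.stalk y) Y.functionField :=
    .of_algebraMap_eq (functionFieldMap_algebraMap f y)
  have : IsScalarTower Γ(X, U) (X.presheaf.stalk (f y)) X.functionField :=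
    functionField_isScalarTower X U ⟨f y, hxU⟩
  have : IsScalarTower Γ(X, U) (Y.presheaf.stalk y) Y.functionField := by
    refine .of_algebraMap_eq fun r => ?_
    rw [IsScalarTower.algebraMap_apply Γ(X, U) X.functionField Y.functionField,
      IsScalarTower.algebraMap_apply Γ(X, U) (X.presheaf.stalk (f y)) X.functionField,
      IsScalarTower.algebraMap_apply Γ(X, U) (X.presheaf.stalk (f y)) (Y.presheaf.stalk y)]
    exact functionFieldMap_algebraMap f y _
  have := functionField_isFractionRing_of_isAffineOpen X U hU
  have := faithfulSMul_of_isFractionRing (X.presheaf.stalk (f y)) (Y.presheaf.stalk y)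
    X.functionField Y.functionField
  obtain ⟨t, ht⟩ := IsStrictlyLocalEtale.exists_isEtaleGenerator
    (A := X.presheaf.stalk (f y)) (B := Y.presheaf.stalk y) h
  obtain ⟨T, hT⟩ := hT
  obtain ⟨c, hc, het⟩ := exists_etale_away (K := X.functionField) (L := Y.functionField)
    (germ_injective_of_isIntegral Y y hy) (hU.primeIdealOf ⟨f y, hxU⟩).asIdeal
    (hV.primeIdealOf ⟨y, hy⟩).asIdeal ht T hT
  exact ⟨Y.basicOpen c, (mem_basicOpen_iff_notMem_primeIdealOf hV hy c).2 hc,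
    etale_basicOpen_ι_comp f hU hV e c het⟩

theorem isStrictlyLocalEtale_stalkMap_iff (hf : IsNormalizedFiniteType f) {y : Y}
    (hx : IsNormalAt X (f y)) (hy : IsIsolatedInFiber f y) :
    IsStrictlyLocalEtale (f.stalkMap y).hom ↔ ValuativeCondition f y := by
  let : Algebra (X.presheaf.stalk (f y)) (Y.presheaf.stalk y) := (f.stalkMap y).hom.toAlgebra
  have : IsIntegrallyClosed (X.presheaf.stalk (f y)) := hx
  let : Algebra X.functionField Y.functionField := (functionFieldMap f).toAlgebra
  let : Algebra (X.presheaf.stalk (f y)) Y.functionField :=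
    ((algebraMap X.functionField Y.functionField).comp
      (algebraMap (X.presheaf.stalk (f y)) X.functionField)).toAlgebra
  have : IsScalarTower (X.presheaf.stalk (f y)) X.functionField Y.functionField :=
    .of_algebraMap_eq' rfl
  have : IsScalarTower (X.presheaf.stalk (f y)) (Y.presheaf.stalk y) Y.functionField :=
    .of_algebraMap_eq (functionFieldMap_algebraMap f y)
  have : IsLocalHom (algebraMap (X.presheaf.stalk (f y)) (Y.presheaf.stalk y)) :=
    inferInstanceAs (IsLocalHom (f.stalkMap y).hom)
  exact isStrictlyLocalEtale_iff_exists_valuationSubring (K := X.functionField)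
    (L := Y.functionField) (exists_isIntegral_stalk_mul_eq hf hy)

/-- Étaleness near `y` always passes to the local rings. The alternative in `h` serves the converse,
where it puts all sections near `y` into a single standard étale algebra. -/
theorem isStrictlyEtaleAt_iff (hf : IsNormalizedFiniteType f) {y : Y}
    (hx : IsNormalAt X (f y)) (h : IsNormalNear X (f y) ∨ IsFiniteTypeNear f y) :
    IsStrictlyEtaleAt f y ↔ IsStrictlyLocalEtale (f.stalkMap y).hom := by
  refine ⟨fun h => ⟨isEssentiallyEtale_stalkMap h.1, inferInstance, h.2⟩,
    fun het => ⟨?_, het.2.choose_spec⟩⟩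
  rcases h with ⟨W, hW, hWn⟩ | ⟨W, hW, hWf⟩
  · obtain ⟨U, V, e, hU, hV, hUW, hyV, T, hT⟩ := hf.exists_isIntegral_adjoin hW
    exact isEtaleAt_of_isStrictlyLocalEtale f hU hV e hyV hx het ⟨T, .inr
      ⟨isIntegrallyClosed_of_isNormalAt hU ⟨⟨_, e hyV⟩⟩ fun z hz => hWn z (hUW hz), hT⟩⟩
  · obtain ⟨U, hU, hxU, -⟩ :=
      exists_isAffineOpen_mem_and_subset (TopologicalSpace.Opens.mem_top (f y))
    obtain ⟨V, hV, hyV, hVW⟩ := exists_isAffineOpen_mem_and_subset (x := y) (U := W ⊓ f ⁻¹ᵁ U)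
      ⟨hW, hxU⟩
    have hVW' : V ≤ W := fun z hz => (hVW hz).1
    have e : V ≤ f ⁻¹ᵁ U := fun z hz => (hVW hz).2
    have : LocallyOfFiniteType (V.ι ≫ f) := by
      rw [← homOfLE_comp_ι_comp f hVW']
      infer_instance
    let : Algebra Γ(X, U) Γ(Y, V) := (f.appLE U V e).hom.toAlgebra
    have hft : Algebra.FiniteType Γ(X, U) Γ(Y, V) := finiteType_appLE f hU hV e
    obtain ⟨T, hT⟩ := hft.out
    exact isEtaleAt_of_isStrictlyLocalEtale f hU hV e hyV hx het ⟨T, .inl hT⟩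

end Schemes

end BirationalEtale

theorem theorem1p10 {X Y : Scheme.{u}} [IsIntegral X] [IsIntegral Y] (f : Y ⟶ X) [IsDominant f]
    (hf : BirationalEtale.IsNormalizedFiniteType f) (x : X) (y : Y) (hxy : f y = x)
    (hx : BirationalEtale.IsNormalAt X x) (hy : BirationalEtale.IsIsolatedInFiber f y) :
    (BirationalEtale.IsStrictlyLocalEtale (f.stalkMap y).hom ↔
      BirationalEtale.ValuativeCondition f y) ∧
    (BirationalEtale.IsNormalNear X x ∨ BirationalEtale.IsFiniteTypeNear f y →
      (BirationalEtale.IsStrictlyEtaleAt f y ↔ BirationalEtale.ValuativeCondition f y)) := by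
  subst hxy
  have h := BirationalEtale.isStrictlyLocalEtale_stalkMap_iff f hf hx hy
  exact ⟨h, fun hn => (BirationalEtale.isStrictlyEtaleAt_iff f hf hx hn).trans h⟩
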